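/- **Setting.** Let $G$ be a finite or countable alphabet with the discrete $\sigma$-algebra, and let $G^{\mathbb Z}$ carry the product $\sigma$-algebra. A history is a sequence $w_{-1},w_{-2},\dots$ in $G$, abbreviated $w_{-\infty}^{-1}$. Let $P(g\mid w_{-\infty}^{-1})$ be a probability transition kernel from histories to $G$ (measurable in the history, $P\ge 0$, and $\sum_{g\in G}P(g\mid w_{-\infty}^{-1})=1$ for every history). A probability measure $\nu$ on $G^{\mathbb Z}$, not necessarily stationary, with coordinate maps $\eta(i)$, is *compatible* with $P$ if for all $i\in\mathbb Z$ and $g\in G$ $$\nu\bigl(\eta(i)=g\mid \eta(i+j),\ j\le -1\bigr)=P\bigl(g\mid \eta(i-1),\eta(i-2),\dots\bigr)\qquad \nu\text{-a.s.}$$ For $k\ge 0$ put $$a_k(g\mid w_{-1},\dots,w_{-k})=\inf_{z}P(g\mid w_{-1},\dots,w_{-k},z_{-1},z_{-2},\dots),\qquad a_k=\inf_{w_{-1},\dots,w_{-k}}\ \sum_{g\in G}a_k(g\mid w_{-1},\dots,w_{-k}),$$ $$\beta_m=\prod_{k=0}^m a_k .$$ Let $\rho_m$ ($m\ge 0$,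 so $\rho_0=1$) be the probability that the Markov chain on $\mathbb N$ with $p(x,x+1)=a_x$, $p(x,0)=1-a_x$, $p(x,y)=0$ otherwise, started at $0$ at time $0$, is at $0$ at time $m$. For $i\le t$, $w\in G^{\mathbb Z}$ and a bounded function $f$ on $G^{\mathbb Z}$ that depends only on the coordinates in $[i,t]$, let $P$ determine the conditional expectation given the history $w_j$, $j<i$, by $$E^{P}\bigl(f\mid \eta(j)=w_j,\ j<i\bigr)=\sum_{g_i,\dots,g_t\in G}\ \prod_{k=i}^{t}P\bigl(g_k\mid g_{k-1},\dots,g_i,w_{i-1},w_{i-2},\dots\bigr)\, f(g_i,\dots,g_t).$$ **The map $\Phi$.** Fix an enumeration $g_1,g_2,\dots$ of $G$ and a point $g_0\in G$. With the convention $a_{-1}(\cdot)=0$, for each history $w$ let $B_k(g\mid w_{-1},\dots,w_{-k})$, $k\ge 0$, $g\in G$, be the left-closed, right-open intervals of length $a_k(g\mid w_{-1},\dots,w_{-k})-a_{k-1}(g\mid w_{-1},\dots,w_{-k+1})$, placed consecutively from the origin in lexicographic order, first in $k$ and then in $g$. For $u\in[0,1)^{\mathbb Z}$ and $n\in\mathbb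 Z$ let $$\tau[n](u)=\max\{s\le n:\ u_j<a_{j-s}\ \text{for all } j\in[s,n]\},$$ with value $-\infty$ if there is no such $s$. If $\tau=\tau[n](u)>-\infty$, define $x_\tau,\dots,x_n$ recursively: $x_m$ is the unique $g\in G$ with $u_m\in\bigcup_{0\le l\le m-\tau}[0,a_{m-\tau})\cap B_l(g\mid x_{m-1},\dots,x_{m-l})$; and put $\Phi(u)(n)=x_n$. If $\tau[n](u)=-\infty$ put $\Phi(u)(n)=g_0$. **Corollary 4.3 (Loss of memory and uniqueness).** (i) Let $\mu$ be any measure compatible with $P$. Let $i\le s\le t$ be integers and let $f$ be a bounded real function on $G^{\mathbb Z}$ that depends only on the coordinates in $[s,t]$. Then $w\mapsto E^{P}(f\mid\eta(j)=w_j,\ j<i)$ is a version of the conditional expectation of $f$ under $\mu$ given $(\eta(j))_{j<i}$, and this version, written $\mu(f\mid \eta(j)=w_j,\ j<i)$, satisfies for every $w,v\in G^{\mathbb Z}$ $$\Bigl|\mu\bigl(f\mid \eta(j)=w_j,\ j<i\bigr)-\mu\bigl(f\mid \eta(j)=v_j,\ j<i\bigr)\Bigr|\ \le\ 2\,\|f\|_\infty\sum_{j=0}^{t-s}\rho_{s+j-i},$$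 where $\|f\|_\infty=\sup|f|$. (ii) If $\sum_{m\ge 0}\beta_m=\infty$, then, for every choice of the enumeration and of $g_0$, the law $\mu$ of $\Phi(U)$, where $U=(U_i)_{i\in\mathbb Z}$ are i.i.d. uniform on $[0,1)$, is compatible with $P$, and it is the only measure compatible with $P$. -/

import Mathlib

open MeasureTheory ProbabilityTheory Filter

namespace LongMemory

/-! A history `w_{-1}, w_{-2}, …` is a function `w : ℕ → G`, with `w m` standing for `w_{-1-m}`.
A transition kernel `P(g | w)` on a countable discrete alphabet is a Markov kernel
`P : Kernel (ℕ → G) G`, and `P(g | w)` is `(P w).real {g}`. -/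

section Kernels

variable {G : Type*}

/-- The history of the configuration `η` strictly before time `i`. -/
def past (i : ℤ) (η : ℤ → G) : ℕ → G := fun m => η (i - 1 - m)

/-- The sigma-algebra generated by the coordinates `η j`, `j < i`. -/
@[reducible] def pastSigma (G : Type*) [MeasurableSpace G] (i : ℤ) : MeasurableSpace (ℤ → G) :=
  MeasurableSpace.comap (past i) inferInstance

/-- The history `w_{-1}, …, w_{-k}, z_{-1}, z_{-2}, …`. -/
def concat (k : ℕ) (w z : ℕ → G) : ℕ → G := fun m => if m < k then w m else z (m - k)

/-- The history `g, w_{-1}, w_{-2}, …`. -/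
def push (g : G) (w : ℕ → G) : ℕ → G
  | 0 => g
  | m + 1 => w m

variable [MeasurableSpace G]

/-- `ν` is a probability measure on `G^ℤ` and `P` is a version of its one-sided conditional
probabilities. -/
def IsCompatible (P : Kernel (ℕ → G) G) (ν : Measure (ℤ → G)) : Prop :=
  IsProbabilityMeasure ν ∧ ∀ (i : ℤ) (g : G),
    ν[Set.indicator {η : ℤ → G | η i = g} (fun _ => (1 : ℝ)) | pastSigma G i]
      =ᵐ[ν] fun η => (P (past i η)).real {g}

/-- `a_k(g | w_{-1}, …, w_{-k})`; it depends only on the first `k` entries of `w`. -/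
noncomputable def aWord (P : Kernel (ℕ → G) G) (k : ℕ) (g : G) (w : ℕ → G) : ℝ :=
  ⨅ z : ℕ → G, (P (concat k w z)).real {g}

/-- `a_k`. -/
noncomputable def aSeq (P : Kernel (ℕ → G) G) (k : ℕ) : ℝ :=
  ⨅ w : ℕ → G, ∑' g : G, aWord P k g w

/-- `β_m = a_0 a_1 ⋯ a_m`. -/
noncomputable def betaSeq (P : Kernel (ℕ → G) G) (m : ℕ) : ℝ :=
  ∏ k ∈ Finset.range (m + 1), aSeq P k

end Kernels

section HouseOfCards

/-- Transition probabilities on `ℕ`: `p(x, x+1) = a_x`, `p(x, 0) = 1 - a_x`, and `0` otherwise. -/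
noncomputable def cardsStep (a : ℕ → ℝ) (x y : ℕ) : ℝ :=
  if y = x + 1 then a x else if y = 0 then 1 - a x else 0

/-- The `n`-step transition probabilities. -/
noncomputable def cardsSteps (a : ℕ → ℝ) : ℕ → ℕ → ℕ → ℝ
  | 0, x, y => if x = y then 1 else 0
  | n + 1, x, y => ∑' z : ℕ, cardsStep a x z * cardsSteps a n z y

/-- `ρ_n`: probability that the chain started at the origin is at the origin at epoch `n`. -/
noncomputable def rho (a : ℕ → ℝ) (n : ℕ) : ℝ := cardsSteps a n 0 0

end HouseOfCards

section ConditionalExpectation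

variable {G : Type*}

/-- The configuration equal to `g` on `[i, t]` and to `w` elsewhere. -/
noncomputable def splice (i t : ℤ) (w : ℤ → G) (g : Set.Icc i t → G) : ℤ → G :=
  fun j => if h : j ∈ Set.Icc i t then g ⟨j, h⟩ else w j

variable [MeasurableSpace G]

/-- Telescopic product: the probability, given the history `w_j`, `j < i`, that the
configuration equals `g` on `[i, t]`, namely `∏_{k=i}^t P(g_k | g_{k-1}, …, g_i, w_{i-1}, …)`. -/
noncomputable def wordProb (P : Kernel (ℕ → G) G) (i t : ℤ) (w : ℤ → G)
    (g : Set.Icc i t → G) : ℝ :=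
  ∏ k : Set.Icc i t, (P (past k (splice i t w g))).real {g k}

/-- The conditional expectation of `f` given `η j = w_j`, `j < i`, that `P` determines for every
`w`, for `f` depending only on coordinates up to time `t`. -/
noncomputable def condMean (P : Kernel (ℕ → G) G) (i t : ℤ) (f : (ℤ → G) → ℝ) (w : ℤ → G) : ℝ :=
  ∑' g : Set.Icc i t → G, wordProb P i t w g * f (splice i t w g)

end ConditionalExpectation

section Construction

/-- The canonical space `[0,1[^ℤ`. -/
abbrev Omega : Type := ℤ → Set.Ico (0 : ℝ) 1

/-- The uniform law on `[0,1[`. -/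
noncomputable def unif : Measure (Set.Ico (0 : ℝ) 1) := Measure.comap Subtype.val volume

instance isProbabilityMeasure_unif : IsProbabilityMeasure unif :=
  ⟨by
    rw [unif, (MeasurableEmbedding.subtype_coe measurableSet_Ico).comap_apply, Set.image_univ,
      Subtype.range_coe]
    simp⟩

/-- The law of an i.i.d. sequence, indexed by `ℤ`, of uniform variables on `[0,1[`. -/
noncomputable def unifLaw : Measure Omega := Measure.infinitePi fun _ : ℤ => unif

variable {G : Type*} [MeasurableSpace G]

/-- `a_{k-1}(g | w)`, with the convention `a_{-1} = 0`. -/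
noncomputable def aPrev (P : Kernel (ℕ → G) G) (k : ℕ) (g : G) (w : ℕ → G) : ℝ :=
  if k = 0 then 0 else aWord P (k - 1) g w

/-- `b_k(g | w) = a_k(g | w) - a_{k-1}(g | w)`. -/
noncomputable def bWord (P : Kernel (ℕ → G) G) (k : ℕ) (g : G) (w : ℕ → G) : ℝ :=
  aWord P k g w - aPrev P k g w

/-- Left end of the interval `B_k(g | w)`, when the intervals are placed consecutively from the
origin in lexicographic order, first in `k` and then in `g`. The order on the alphabet is the one
of the enumeration `e : G → ℕ`. -/
noncomputable def leftEnd (P : Kernel (ℕ → G) G) (e : G → ℕ) (k : ℕ) (g : G) (w : ℕ → G) : ℝ :=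
  (∑' g' : G, aPrev P k g' w) + ∑' g' : {g' : G // e g' < e g}, bWord P k g' w

/-- The interval `B_k(g | w)`, of length `b_k(g | w)`. -/
noncomputable def interval (P : Kernel (ℕ → G) G) (e : G → ℕ) (k : ℕ) (g : G) (w : ℕ → G) :
    Set ℝ :=
  Set.Ico (leftEnd P e k g w) (leftEnd P e k g w + bWord P k g w)

/-- The set of `s ≤ n` such that `u_j < a_{j-s}` for all `j ∈ [s, n]`. Its maximum is `τ[n](u)`;
`τ[n](u) = -∞` if it is empty. -/
def regenSet (P : Kernel (ℕ → G) G) (u : Omega) (n : ℤ) : Set ℤ :=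
  {s | s ≤ n ∧ ∀ j ∈ Set.Icc s n, (u j : ℝ) < aSeq P (j - s).toNat}

open Classical in
/-- The symbol `g` such that `x ∈ ⋃_{l ≤ m} [0, a_m[ ∩ B_l(g | w)`, which uses only the first `m`
entries of `w` (there is at most one such symbol; the value is `g₀` if there is none). -/
noncomputable def symbol (P : Kernel (ℕ → G) G) (e : G → ℕ) (g₀ : G) (m : ℕ) (x : ℝ)
    (w : ℕ → G) : G :=
  if h : ∃ g : G, ∃ l ≤ m, x ∈ Set.Ico 0 (aSeq P m) ∩ interval P e l g w then h.choose else g₀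

/-- The history `x_{s+m-1}, …, x_s` of the symbols constructed recursively from time `s` on
(followed by a filler `g₀`, which is never used). -/
noncomputable def builtPast (P : Kernel (ℕ → G) G) (e : G → ℕ) (g₀ : G) (u : Omega) (s : ℤ) :
    ℕ → ℕ → G
  | 0 => fun _ => g₀
  | m + 1 => push (symbol P e g₀ m (u (s + m)) (builtPast P e g₀ u s m))
      (builtPast P e g₀ u s m)

/-- The symbol `x_{s+m}` constructed recursively from time `s` on. -/
noncomputable def builtSymbol (P : Kernel (ℕ → G) G) (e : G → ℕ) (g₀ : G) (u : Omega) (s : ℤ)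
    (m : ℕ) : G :=
  symbol P e g₀ m (u (s + m)) (builtPast P e g₀ u s m)

open Classical in
/-- The map `Φ : [0,1[^ℤ → G^ℤ`: its value at `n` is the symbol constructed at time `n` by the
recursion started at `τ[n](u)`, and `g₀` if `τ[n](u) = -∞`. -/
noncomputable def Phi (P : Kernel (ℕ → G) G) (e : G → ℕ) (g₀ : G) (u : Omega) : ℤ → G :=
  fun n => if (regenSet P u n).Nonempty then
    builtSymbol P e g₀ u (sSup (regenSet P u n)) (n - sSup (regenSet P u n)).toNat
  else g₀

/-- The law of `Φ(U)`. -/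
noncomputable def muPhi (P : Kernel (ℕ → G) G) (e : G → ℕ) (g₀ : G) : Measure (ℤ → G) :=
  unifLaw.map (Phi P e g₀)

end Construction

end LongMemory

/-! Everything is measured against the house-of-cards chain. The operator `histOp` averages over one
new letter drawn from `P`, and its iterates compute `condMean`. If two histories share their last
`x` letters, the laws of their next letters have a common part of mass at least `aSeq P x`. A letter
from the common part lengthens the agreement to `x + 1`; otherwise the agreement is counted as lost.
So a bound on oscillations by agreement length is propagated by `cardsOp` (`histOp_sub_le`). For `f`
seeing `L = t - s + 1` coordinates, the discrepancy is at most `2‖f‖` times the probability that the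
chain is below `L`. Being at `y` at time `n` requires being at `0` at time `n - y`, whence the sum
of `ρ`.

Since `aSeq P` is nondecreasing, `ρ` is nonincreasing, and the last-exit decomposition bounds `ρ_n`
by `1 / (1 + β_0 + ⋯ + β_{n-1})`. Divergence of `∑ β_m` thus gives `ρ_n → 0`, and also `a_k → 1`.
Uniqueness follows: the expectations of a local `f` under two compatible measures are both close to
one value `condMean P i t f w` as `i → -∞`.

For existence, drive the chain by `u`. If `regenSet P u n` is empty, the chain started `k` steps
earlier sits at `0` after using `u n`, an event of probability `ρ_k` for every `k`; so the set is
almost surely nonempty. Any of its elements, not only the maximum, produces the same symbol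
(`Phi_eq_builtSymbol`). Hence `Φ(u)(n)` is the letter whose intervals, computed from the past of
`Φ(u)`, contain `u n` (`Phi_eq_iff`). That past is independent of `u n`, and the intervals of `g`
have total length `P(g | past)` because `a_k → 1`. -/

namespace LongMemory

/-! ### The house-of-cards chain and the decay of `ρ`. -/

section HouseOfCardsLemmas

/-- The transition operator of the house-of-cards chain. -/
def cardsOp (a : ℕ → ℝ) (h : ℕ → ℝ) (x : ℕ) : ℝ := a x * h (x + 1) + (1 - a x) * h 0

/-- The indicator function of `{y}`. -/
def point (y : ℕ) (x : ℕ) : ℝ := if x = y then 1 else 0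

lemma tsum_cardsStep_mul (a h : ℕ → ℝ) (x : ℕ) :
    ∑' z, cardsStep a x z * h z = cardsOp a h x := by
  rw [tsum_eq_sum (s := {x + 1, 0})]
  · rw [Finset.sum_pair (by omega)]
    simp [cardsStep, cardsOp]
  · intro z hz
    simp only [Finset.mem_insert, Finset.mem_singleton, not_or] at hz
    simp [cardsStep, hz.1, hz.2]

lemma cardsSteps_eq_iterate (a : ℕ → ℝ) (n x y : ℕ) :
    cardsSteps a n x y = (cardsOp a)^[n] (point y) x := by
  induction n generalizing x with
  | zero => simp [cardsSteps, point]
  | succ n ih =>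
    rw [cardsSteps, Function.iterate_succ_apply', ← tsum_cardsStep_mul]
    simp only [ih]

lemma rho_eq_iterate (a : ℕ → ℝ) (n : ℕ) : rho a n = (cardsOp a)^[n] (point 0) 0 :=
  cardsSteps_eq_iterate a n 0 0

variable {a : ℕ → ℝ}

lemma cardsOp_mono (ha : ∀ x, a x ∈ Set.Icc (0 : ℝ) 1) : Monotone (cardsOp a) := by
  intro h h' hh x
  have := ha x
  simp only [cardsOp]
  gcongr
  · exact this.1
  · exact hh _
  · linarith [this.2]
  · exact hh _

lemma cardsOp_iterate_const (c : ℝ) (n : ℕ) :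
    (cardsOp a)^[n] (fun _ => c) = fun _ => c := by
  induction n with
  | zero => rfl
  | succ n ih =>
    rw [Function.iterate_succ_apply', ih]
    ext x
    simp only [cardsOp]
    ring

lemma cardsOp_sum {ι : Type*} (s : Finset ι) (h : ι → ℕ → ℝ) :
    cardsOp a (∑ i ∈ s, h i) = ∑ i ∈ s, cardsOp a (h i) := by
  ext x
  simp [cardsOp, Finset.sum_apply, Finset.mul_sum, Finset.sum_add_distrib]

lemma cardsOp_iterate_sum {ι : Type*} (s : Finset ι) (h : ι → ℕ → ℝ) (n : ℕ) :
    (cardsOp a)^[n] (∑ i ∈ s, h i) = ∑ i ∈ s, (cardsOp a)^[n] (h i) := by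
  induction n generalizing h with
  | zero => rfl
  | succ n ih => simp only [Function.iterate_succ_apply, cardsOp_sum, ih]

lemma cardsOp_smul (c : ℝ) (h : ℕ → ℝ) : cardsOp a (c • h) = c • cardsOp a h := by
  ext x
  simp only [cardsOp, Pi.smul_apply, smul_eq_mul]
  ring

lemma cardsOp_iterate_smul (c : ℝ) (h : ℕ → ℝ) (n : ℕ) :
    (cardsOp a)^[n] (c • h) = c • (cardsOp a)^[n] h := by
  induction n generalizing h with
  | zero => rfl
  | succ n ih => simp only [Function.iterate_succ_apply, cardsOp_smul, ih]

/-- A higher state climbs with larger probability, to a place where `h` is smaller, and falls to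
`0`, where `h` is largest, with smaller probability. -/
lemma cardsOp_antitone (ha : ∀ x, a x ∈ Set.Icc (0 : ℝ) 1) (hm : Monotone a) {h : ℕ → ℝ}
    (hh : Antitone h) : Antitone (cardsOp a h) := by
  refine antitone_nat_of_succ_le fun x => ?_
  have h1 := hh (Nat.le_succ (x + 1))
  have h2 := hh (Nat.zero_le (x + 1))
  have h3 := hm (Nat.le_succ x)
  have h4 := ha (x + 1)
  simp only [cardsOp, Nat.succ_eq_add_one] at *
  nlinarith [mul_nonneg h4.1 (sub_nonneg.2 h1), mul_nonneg (sub_nonneg.2 h3) (sub_nonneg.2 h2)]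

lemma cardsOp_iterate_antitone (ha : ∀ x, a x ∈ Set.Icc (0 : ℝ) 1) (hm : Monotone a)
    {h : ℕ → ℝ} (hh : Antitone h) (n : ℕ) : Antitone ((cardsOp a)^[n] h) := by
  induction n with
  | zero => exact hh
  | succ n ih =>
    rw [Function.iterate_succ_apply']
    exact cardsOp_antitone ha hm ih

lemma point_zero_antitone : Antitone (point 0) := by
  intro x y hxy
  simp only [point]
  split_ifs <;> first | omega | norm_num

lemma point_nonneg (y : ℕ) : 0 ≤ point y := by
  intro x
  simp only [point, Pi.zero_apply]
  split_ifs <;> norm_num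

/-- One extra initial step replaces the value at `0` by an average of the values at `0` and `1`, and
the iterates of `point 0` are antitone. -/
lemma rho_antitone (ha : ∀ x, a x ∈ Set.Icc (0 : ℝ) 1) (hm : Monotone a) : Antitone (rho a) := by
  refine antitone_nat_of_succ_le fun n => ?_
  have h := cardsOp_iterate_antitone ha hm point_zero_antitone n (Nat.zero_le 1)
  rw [rho_eq_iterate, rho_eq_iterate, Function.iterate_succ_apply']
  simp only [cardsOp, zero_add]
  nlinarith [(ha 0).1]

lemma cardsOp_point_succ (y : ℕ) : cardsOp a (point (y + 1)) = a y • point y := by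
  ext x
  by_cases h : x = y <;> simp [cardsOp, point, h]

/-- State `y + 1` is entered only from `y`, so being at `y` at time `n + y` means being at the
origin at time `n` and then climbing `y` times. -/
lemma cardsOp_iterate_point (n y : ℕ) :
    (cardsOp a)^[n + y] (point y) 0 = (∏ k ∈ Finset.range y, a k) * rho a n := by
  induction y with
  | zero => simp [rho_eq_iterate]
  | succ y ih =>
    rw [← add_assoc, Function.iterate_succ_apply, cardsOp_point_succ, cardsOp_iterate_smul,
      Pi.smul_apply, ih, Finset.prod_range_succ, smul_eq_mul]
    ring

lemma rho_nonneg (ha : ∀ x, a x ∈ Set.Icc (0 : ℝ) 1) (n : ℕ) : 0 ≤ rho a n := by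
  have := (cardsOp_mono ha).iterate n (point_nonneg 0)
  rw [rho_eq_iterate]
  refine le_trans (le_of_eq ?_) (this 0)
  exact (congrFun (cardsOp_iterate_const (a := a) 0 n) 0).symm

/-- The probability that the chain is below `L` at time `n`. -/
lemma cardsOp_iterate_lt_le (ha : ∀ x, a x ∈ Set.Icc (0 : ℝ) 1) {n L : ℕ} (hL : L ≤ n) :
    (cardsOp a)^[n] (∑ y ∈ Finset.range L, point y) 0 ≤ ∑ y ∈ Finset.range L, rho a (n - y) := by
  rw [cardsOp_iterate_sum, Finset.sum_apply]
  refine Finset.sum_le_sum fun y hy => ?_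
  have hyn : n - y + y = n := by
    have := Finset.mem_range.1 hy
    omega
  conv_lhs => rw [← hyn]
  rw [cardsOp_iterate_point]
  exact mul_le_of_le_one_left (rho_nonneg ha _)
    (Finset.prod_le_one (fun k _ => (ha k).1) fun k _ => (ha k).2)

/-- Last-exit decomposition, combined with the monotonicity of `ρ`. -/
lemma rho_mul_sum_le (ha : ∀ x, a x ∈ Set.Icc (0 : ℝ) 1) (hm : Monotone a) (n : ℕ) :
    rho a n * ∑ y ∈ Finset.range (n + 1), ∏ k ∈ Finset.range y, a k ≤ 1 := by
  have h1 : (∑ y ∈ Finset.range (n + 1), point y) ≤ fun _ => (1 : ℝ) := by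
    intro x
    rw [Finset.sum_apply]
    simp only [point, Finset.sum_ite_eq]
    split_ifs <;> norm_num
  have h2 := (cardsOp_mono ha).iterate n h1 0
  rw [cardsOp_iterate_const, cardsOp_iterate_sum, Finset.sum_apply] at h2
  refine le_trans ?_ h2
  rw [Finset.mul_sum]
  refine Finset.sum_le_sum fun y hy => ?_
  have hyn : n - y + y = n := by
    have := Finset.mem_range.1 hy
    omega
  conv_rhs => rw [← hyn]
  rw [cardsOp_iterate_point, mul_comm]
  exact mul_le_mul_of_nonneg_left (rho_antitone ha hm (Nat.sub_le _ _))
    (Finset.prod_nonneg fun k _ => (ha k).1)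

lemma tendsto_rho (ha : ∀ x, a x ∈ Set.Icc (0 : ℝ) 1) (hm : Monotone a)
    (hb : Tendsto (fun n => ∑ m ∈ Finset.range n, ∏ k ∈ Finset.range (m + 1), a k) atTop atTop) :
    Tendsto (rho a) atTop (nhds 0) := by
  have h1 : Tendsto (fun n => 1 + ∑ m ∈ Finset.range n, ∏ k ∈ Finset.range (m + 1), a k)
      atTop atTop := tendsto_atTop_add_const_left _ _ hb
  refine squeeze_zero (rho_nonneg ha) (fun n => ?_) h1.inv_tendsto_atTop
  have h2 := rho_mul_sum_le ha hm n
  -- The term `y = 0` is an empty product; the others are the `β_m` with `m < n`.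
  rw [Finset.sum_range_succ', Finset.prod_range_zero, add_comm] at h2
  have h3 : 0 ≤ ∑ m ∈ Finset.range n, ∏ k ∈ Finset.range (m + 1), a k :=
    Finset.sum_nonneg fun m _ => Finset.prod_nonneg fun k _ => (ha k).1
  rw [Pi.inv_apply, ← one_div, le_div_iff₀ (by linarith)]
  exact h2

/-- If the supremum `c` of `a` were below `1`, the products would be dominated by a geometric
series. -/
lemma tendsto_one_of_sum_prod (ha : ∀ x, a x ∈ Set.Icc (0 : ℝ) 1) (hm : Monotone a)
    (hb : Tendsto (fun n => ∑ m ∈ Finset.range n, ∏ k ∈ Finset.range (m + 1), a k) atTop atTop) :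
    Tendsto a atTop (nhds 1) := by
  have hbdd : BddAbove (Set.range a) := ⟨1, by rintro _ ⟨x, rfl⟩; exact (ha x).2⟩
  have hlim := tendsto_atTop_ciSup hm hbdd
  set c := ⨆ x, a x with hc
  have hac : ∀ x, a x ≤ c := fun x => le_ciSup hbdd x
  have hc1 : c ≤ 1 := ciSup_le fun x => (ha x).2
  have hc0 : 0 ≤ c := (ha 0).1.trans (hac 0)
  rcases hc1.lt_or_eq with hlt | heq
  · exfalso
    obtain ⟨n, hn⟩ := (hb.eventually_gt_atTop (1 - c)⁻¹).exists
    refine absurd hn (not_lt.2 ?_)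
    calc ∑ m ∈ Finset.range n, ∏ k ∈ Finset.range (m + 1), a k
        ≤ ∑ m ∈ Finset.range n, c ^ m := by
          refine Finset.sum_le_sum fun m _ => ?_
          rw [Finset.prod_range_succ]
          refine le_trans (mul_le_of_le_one_right (Finset.prod_nonneg fun k _ => (ha k).1)
            (ha m).2) ?_
          calc ∏ k ∈ Finset.range m, a k ≤ ∏ k ∈ Finset.range m, c :=
                Finset.prod_le_prod (fun k _ => (ha k).1) fun k _ => hac k
            _ = c ^ m := by simp
      _ ≤ ∑' m, c ^ m := (summable_geometric_of_lt_one hc0 hlt).sum_le_tsum _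
            fun m _ => pow_nonneg hc0 m
      _ = (1 - c)⁻¹ := tsum_geometric_of_lt_one hc0 hlt
  · rwa [heq] at hlim

end HouseOfCardsLemmas

/-! ### Countable sums and measurability on the space of histories. -/

section Kernels

lemma integrable_of_abs_le {α : Type*} [MeasurableSpace α] {ν : Measure α} [IsFiniteMeasure ν]
    {φ : α → ℝ} (hφ : Measurable φ) {C : ℝ} (hC : ∀ x, |φ x| ≤ C) : Integrable φ ν :=
  Integrable.of_bound hφ.aestronglyMeasurable C (Eventually.of_forall hC)

lemma abs_integral_le_of_abs_le {α : Type*} [MeasurableSpace α] {ν : Measure α}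
    [IsProbabilityMeasure ν] {φ : α → ℝ} {C : ℝ} (hC : ∀ x, |φ x| ≤ C) : |∫ x, φ x ∂ν| ≤ C := by
  simpa using norm_integral_le_of_norm_le_const (μ := ν) (f := φ) (Eventually.of_forall hC)

/-- Summable families dominated by a summable family times a constant. -/
lemma summable_mul_of_abs_le {ι : Type*} {q φ : ι → ℝ} (hq : Summable q) (hq0 : ∀ g, 0 ≤ q g)
    {C : ℝ} (hC : ∀ g, |φ g| ≤ C) : Summable fun g => q g * φ g := by
  refine Summable.of_norm_bounded (hq.mul_right C) fun g => ?_
  rw [Real.norm_eq_abs, abs_mul, abs_of_nonneg (hq0 g)]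
  exact mul_le_mul_of_nonneg_left (hC g) (hq0 g)

variable {G : Type*}

lemma push_agree {x : ℕ} {w v : ℕ → G} (h : ∀ m < x, w m = v m) (g : G) :
    ∀ m < x + 1, push g w m = push g v m := by
  intro m hm
  cases m with
  | zero => rfl
  | succ m => exact h m (by omega)

lemma measurable_push [MeasurableSpace G] (g : G) : Measurable (push g) := by
  refine measurable_pi_lambda _ fun m => ?_
  cases m with
  | zero => exact measurable_const
  | succ m => exact measurable_pi_apply m

variable [Countable G] [MeasurableSpace G] [DiscreteMeasurableSpace G]

lemma hasSum_real_singleton (p : Measure G) [IsProbabilityMeasure p] :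
    HasSum (fun g => p.real {g}) 1 := by
  have h : ∑' g, p {g} = 1 := by
    have := lintegral_countable' (μ := p) (fun _ => 1)
    simpa using this.symm
  have h2 := ENNReal.hasSum_toReal (f := fun g => p {g}) (by rw [h]; simp)
  rw [← ENNReal.tsum_toReal_eq (fun g => measure_ne_top _ _), h] at h2
  simpa [measureReal_def] using h2

lemma hasSum_integral (p : Measure G) [IsProbabilityMeasure p] {φ : G → ℝ} {C : ℝ}
    (hC : ∀ g, |φ g| ≤ C) : HasSum (fun g => p.real {g} * φ g) (∫ g, φ g ∂p) := by
  have h := summable_mul_of_abs_le (hasSum_real_singleton p).summable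
    (fun g => measureReal_nonneg) hC
  rw [integral_countable (integrable_of_abs_le (Measurable.of_discrete) hC)]
  exact h.hasSum

/-- A function of a history that depends only on finitely many entries is measurable. -/
lemma measurable_of_agree {β : Type*} [MeasurableSpace β] {φ : (ℕ → G) → β} (k : ℕ)
    (h : ∀ w v : ℕ → G, (∀ m < k, w m = v m) → φ w = φ v) : Measurable φ := by
  rcases isEmpty_or_nonempty G with hG | ⟨⟨g⟩⟩
  · exact measurable_of_empty φ
  · have : φ = (fun y : Fin k → G => φ fun m => if hm : m < k then y ⟨m, hm⟩ else g) ∘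
        fun w m => w m := by
      ext w
      refine h _ _ fun m hm => ?_
      simp [hm]
    rw [this]
    exact (measurable_of_countable _).comp (by fun_prop)

lemma measurable_push_prod : Measurable fun x : G × (ℕ → G) => push x.1 x.2 :=
  measurable_from_prod_countable_right fun g => measurable_push g

end Kernels

/-! ### Minimal probabilities `a_k(g | w)` and the sequence `a_k`. -/

section MinimalProbabilities

variable {G : Type*}

lemma concat_congr {k : ℕ} {w v : ℕ → G} (h : ∀ m < k, w m = v m) (z : ℕ → G) :
    concat k w z = concat k v z := by
  ext m
  simp only [concat]
  split_ifs with hm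
  exacts [h m hm, rfl]

lemma concat_eq {k : ℕ} {w v : ℕ → G} (h : ∀ m < k, w m = v m) :
    concat k w (fun m => v (m + k)) = v := by
  ext m
  simp only [concat]
  split_ifs with hm
  · exact h m hm
  · rw [Nat.sub_add_cancel (not_lt.1 hm)]

variable [MeasurableSpace G] (P : Kernel (ℕ → G) G)

lemma bddBelow_prob (k : ℕ) (g : G) (w : ℕ → G) :
    BddBelow (Set.range fun z : ℕ → G => (P (concat k w z)).real {g}) :=
  ⟨0, by rintro _ ⟨z, rfl⟩; exact measureReal_nonneg⟩

lemma aWord_nonneg (k : ℕ) (g : G) (w : ℕ → G) : 0 ≤ aWord P k g w :=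
  Real.iInf_nonneg fun _ => measureReal_nonneg

lemma aWord_congr {k : ℕ} {w v : ℕ → G} (h : ∀ m < k, w m = v m) (g : G) :
    aWord P k g w = aWord P k g v := by
  simp only [aWord, concat_congr h]

lemma aWord_le_of_agree {k : ℕ} {w v : ℕ → G} (h : ∀ m < k, w m = v m) (g : G) :
    aWord P k g w ≤ (P v).real {g} := by
  have := ciInf_le (bddBelow_prob P k g w) (fun m => v (m + k))
  rwa [concat_eq h] at this

lemma aWord_le (k : ℕ) (g : G) (w : ℕ → G) : aWord P k g w ≤ (P w).real {g} :=
  aWord_le_of_agree P (fun _ _ => rfl) g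

lemma aWord_mono (g : G) (w : ℕ → G) : Monotone fun k => aWord P k g w := by
  intro k l hkl
  have : Nonempty (ℕ → G) := ⟨w⟩
  refine le_ciInf fun z => aWord_le_of_agree P (fun m hm => ?_) g
  simp [concat, hm.trans_le hkl]

lemma aSeq_le (k : ℕ) (w : ℕ → G) : aSeq P k ≤ ∑' g, aWord P k g w :=
  ciInf_le ⟨0, by rintro _ ⟨w, rfl⟩; exact tsum_nonneg fun g => aWord_nonneg P k g w⟩ w

variable [Countable G] [DiscreteMeasurableSpace G] [IsMarkovKernel P]

lemma summable_aWord (k : ℕ) (w : ℕ → G) : Summable fun g => aWord P k g w :=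
  Summable.of_nonneg_of_le (fun g => aWord_nonneg P k g w) (fun g => aWord_le P k g w)
    (hasSum_real_singleton (P w)).summable

lemma tsum_aWord_le_one (k : ℕ) (w : ℕ → G) : ∑' g, aWord P k g w ≤ 1 := by
  rw [← (hasSum_real_singleton (P w)).tsum_eq]
  exact (summable_aWord P k w).tsum_le_tsum (fun g => aWord_le P k g w)
    (hasSum_real_singleton (P w)).summable

lemma tsum_aWord_mono (w : ℕ → G) : Monotone fun k => ∑' g, aWord P k g w := fun k l hkl =>
  (summable_aWord P k w).tsum_le_tsum (fun g => aWord_mono P g w hkl) (summable_aWord P l w)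

lemma aSeq_mem_Icc (k : ℕ) : aSeq P k ∈ Set.Icc (0 : ℝ) 1 := by
  refine ⟨Real.iInf_nonneg fun w => tsum_nonneg fun g => aWord_nonneg P k g w, ?_⟩
  rcases isEmpty_or_nonempty (ℕ → G) with h | ⟨⟨w⟩⟩
  -- For an empty alphabet the real infimum over no histories is `0`.
  · simp [aSeq]
  · exact (aSeq_le P k w).trans (tsum_aWord_le_one P k w)

lemma aSeq_mono : Monotone (aSeq P) := by
  intro k l hkl
  rcases isEmpty_or_nonempty (ℕ → G) with h | h
  · simp [aSeq]
  · exact le_ciInf fun w => (aSeq_le P k w).trans (tsum_aWord_mono P w hkl)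

end MinimalProbabilities

/-! ### Contraction of oscillations under one transition. -/

section Contraction

variable {G : Type*} [MeasurableSpace G] (P : Kernel (ℕ → G) G)

/-- The transition operator of the history-valued chain. -/
noncomputable def histOp (φ : (ℕ → G) → ℝ) (w : ℕ → G) : ℝ := ∫ g, φ (push g w) ∂P w

variable [IsMarkovKernel P]

lemma abs_histOp_iterate_le {φ : (ℕ → G) → ℝ} {C : ℝ} (hC : ∀ w, |φ w| ≤ C) (n : ℕ)
    (w : ℕ → G) : |(histOp P)^[n] φ w| ≤ C := by
  induction n generalizing w with
  | zero => exact hC w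
  | succ n ih =>
    rw [Function.iterate_succ_apply']
    exact abs_integral_le_of_abs_le fun _ => ih _

variable [Countable G] [DiscreteMeasurableSpace G]

lemma measurable_histOp {φ : (ℕ → G) → ℝ} (hφ : Measurable φ) : Measurable (histOp P φ) := by
  exact (StronglyMeasurable.integral_kernel_prod_right' (κ := P)
    (hφ.comp (measurable_push_prod.comp measurable_swap)).stronglyMeasurable).measurable

/-- Both laws are split into the common part `q`, of mass `r ≥ aSeq P x`, and remainders of mass `1
- r`. The common part contributes at most `r * h (x + 1)` and the remainders at most `(1 - r) * h
0`. No coupling is constructed. -/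
lemma histOp_sub_le {φ : (ℕ → G) → ℝ} {C : ℝ} (hC : ∀ w, |φ w| ≤ C) {h : ℕ → ℝ}
    (hh : Antitone h)
    (hφ : ∀ (x : ℕ) (w v : ℕ → G), (∀ m < x, w m = v m) → φ w - φ v ≤ h x)
    (x : ℕ) (w v : ℕ → G) (hwv : ∀ m < x, w m = v m) :
    histOp P φ w - histOp P φ v ≤ cardsOp (aSeq P) h x := by
  set q : G → ℝ := fun g => aWord P x g w with hq
  have hqs : Summable q := summable_aWord P x w
  set r := ∑' g, q g with hr
  have har : aSeq P x ≤ r := aSeq_le P x w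
  have hr1 : r ≤ 1 := tsum_aWord_le_one P x w
  have hq0 : ∀ g, 0 ≤ q g := fun g => aWord_nonneg P x g w
  have hqw : ∀ g, 0 ≤ (P w).real {g} - q g := fun g => sub_nonneg.2 (aWord_le P x g w)
  have hqv : ∀ g, 0 ≤ (P v).real {g} - q g := fun g => sub_nonneg.2 (aWord_le_of_agree P hwv g)
  have hpw := (hasSum_real_singleton (P w)).sub hqs.hasSum
  have hpv := (hasSum_real_singleton (P v)).sub hqs.hasSum
  have hφw : ∀ g, |φ (push g w)| ≤ C := fun g => hC _
  have hφv : ∀ g, |φ (push g v)| ≤ C := fun g => hC _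
  -- The remainders carry different weights, so their integrands are compared through a constant:
  -- `M` bounds one from above and `M - h 0` the other from below.
  set M := ⨆ g, φ (push g w) with hM
  have hMbdd : BddAbove (Set.range fun g => φ (push g w)) :=
    ⟨C, by rintro _ ⟨g, rfl⟩; exact (abs_le.1 (hφw g)).2⟩
  have : Nonempty G := ⟨w 0⟩
  have hMle : ∀ g, M - h 0 ≤ φ (push g v) := fun g => by
    rw [sub_le_iff_le_add]
    refine ciSup_le fun g' => ?_
    linarith [hφ 0 (push g' w) (push g v) (by simp)]
  have s1 : Summable fun g => q g * φ (push g w) := summable_mul_of_abs_le hqs hq0 hφw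
  have s2 : Summable fun g => q g * φ (push g v) := summable_mul_of_abs_le hqs hq0 hφv
  have i1 : histOp P φ w =
      ∑' g, q g * φ (push g w) + ∑' g, ((P w).real {g} - q g) * φ (push g w) := by
    rw [← s1.tsum_add (summable_mul_of_abs_le hpw.summable hqw hφw)]
    refine (hasSum_integral (P w) hφw).tsum_eq.symm.trans (tsum_congr fun g => by ring)
  have i2 : histOp P φ v =
      ∑' g, q g * φ (push g v) + ∑' g, ((P v).real {g} - q g) * φ (push g v) := by
    rw [← s2.tsum_add (summable_mul_of_abs_le hpv.summable hqv hφv)]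
    refine (hasSum_integral (P v) hφv).tsum_eq.symm.trans (tsum_congr fun g => by ring)
  have b1 : ∑' g, ((P w).real {g} - q g) * φ (push g w) ≤ (1 - r) * M := by
    rw [← (hpw.mul_right M).tsum_eq]
    exact (summable_mul_of_abs_le hpw.summable hqw hφw).tsum_le_tsum
      (fun g => mul_le_mul_of_nonneg_left (le_ciSup hMbdd g) (hqw g)) (hpw.mul_right M).summable
  have b2 : (1 - r) * (M - h 0) ≤ ∑' g, ((P v).real {g} - q g) * φ (push g v) := by
    rw [← (hpv.mul_right (M - h 0)).tsum_eq]
    exact (hpv.mul_right (M - h 0)).summable.tsum_le_tsum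
      (fun g => mul_le_mul_of_nonneg_left (hMle g) (hqv g))
      (summable_mul_of_abs_le hpv.summable hqv hφv)
  have b3 : ∑' g, q g * φ (push g w) - ∑' g, q g * φ (push g v) ≤ r * h (x + 1) := by
    rw [← s1.tsum_sub s2, hr, ← tsum_mul_right]
    refine (s1.sub s2).tsum_le_tsum (fun g => ?_) (hqs.mul_right _)
    rw [← mul_sub]
    exact mul_le_mul_of_nonneg_left (hφ _ _ _ (push_agree hwv g)) (hq0 g)
  -- As `h` is antitone, lowering the common mass from `r` to `aSeq P x` only increases the bound.
  have b4 := mul_nonneg (sub_nonneg.2 har) (sub_nonneg.2 (hh (Nat.zero_le (x + 1))))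
  rw [i1, i2, cardsOp]
  linarith

lemma histOp_iterate_sub_le {φ : (ℕ → G) → ℝ} {C : ℝ} (hC : ∀ w, |φ w| ≤ C) {h : ℕ → ℝ}
    (hh : Antitone h)
    (hφ : ∀ (x : ℕ) (w v : ℕ → G), (∀ m < x, w m = v m) → φ w - φ v ≤ h x) (n : ℕ)
    (x : ℕ) (w v : ℕ → G) (hwv : ∀ m < x, w m = v m) :
    (histOp P)^[n] φ w - (histOp P)^[n] φ v ≤ (cardsOp (aSeq P))^[n] h x := by
  induction n generalizing x w v with
  | zero => exact hφ x w v hwv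
  | succ n ih =>
    simp only [Function.iterate_succ_apply']
    exact histOp_sub_le P (abs_histOp_iterate_le P hC n)
      (cardsOp_iterate_antitone (aSeq_mem_Icc P) (aSeq_mono P) hh n) ih x w v hwv

/-- Loss of memory on the level of histories. -/
lemma abs_histOp_iterate_sub_le {φ : (ℕ → G) → ℝ} {C : ℝ} (hC : ∀ w, |φ w| ≤ C) {L n : ℕ}
    (hL : L ≤ n) (hφ : ∀ w v : ℕ → G, (∀ m < L, w m = v m) → φ w = φ v) (w v : ℕ → G) :
    |(histOp P)^[n] φ w - (histOp P)^[n] φ v| ≤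
      2 * C * ∑ y ∈ Finset.range L, rho (aSeq P) (n - y) := by
  have hC0 : 0 ≤ C := (abs_nonneg _).trans (hC w)
  have hpt : ∀ x, (∑ y ∈ Finset.range L, point y) x = if x < L then (1 : ℝ) else 0 := by
    intro x
    simp [Finset.sum_apply, point]
  have key : ∀ w v : ℕ → G, (histOp P)^[n] φ w - (histOp P)^[n] φ v ≤
      2 * C * ∑ y ∈ Finset.range L, rho (aSeq P) (n - y) := by
    intro w v
    -- The initial oscillation bound is `2 * C` times the indicator of `x < L`: beyond `L` common
    -- letters `φ` does not vary at all.
    have hanti : Antitone ((2 * C) • ∑ y ∈ Finset.range L, point y) := by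
      intro x y hxy
      simp only [Pi.smul_apply, smul_eq_mul, hpt]
      split_ifs <;> first | omega | linarith
    have := histOp_iterate_sub_le P hC hanti (fun x w v hwv => ?_) n 0 w v (by simp)
    · rw [cardsOp_iterate_smul, Pi.smul_apply, smul_eq_mul] at this
      exact this.trans (mul_le_mul_of_nonneg_left
        (cardsOp_iterate_lt_le (aSeq_mem_Icc P) hL) (by linarith))
    · simp only [Pi.smul_apply, smul_eq_mul, hpt]
      split_ifs with hx
      · linarith [(abs_le.1 (hC w)).2, (abs_le.1 (hC v)).1]
      · rw [hφ w v fun m hm => hwv m (by omega)]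
        simp
  exact abs_sub_le_iff.2 ⟨key w v, key v w⟩

end Contraction

/-! ### Finite words and the telescopic product. -/

section Words

variable {G : Type*}

lemma past_succ (i : ℤ) (η : ℤ → G) : past (i + 1) η = push (η i) (past i η) := by
  ext m
  cases m with
  | zero => simp [past, push]
  | succ m =>
    simp only [past, push]
    congr 1
    push_cast
    ring

lemma past_congr {i : ℤ} {η ζ : ℤ → G} (h : ∀ j < i, η j = ζ j) : past i η = past i ζ := by
  ext m
  exact h _ (by omega)

/-- A word on `[i, t]` is a letter at `i` and a word on `[i + 1, t]`. -/
def wordEquiv (G : Type*) {i t : ℤ} (h : i ≤ t) :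
    (Set.Icc i t → G) ≃ G × (Set.Icc (i + 1) t → G) where
  toFun x := (x ⟨i, le_rfl, h⟩, fun k => x ⟨k, by have := k.2.1; omega, k.2.2⟩)
  invFun y k := if hk : (k : ℤ) = i then y.1 else
    y.2 ⟨k, by have := k.2.1; omega, k.2.2⟩
  left_inv x := by
    ext k
    by_cases hk : (k : ℤ) = i
    · simp only [hk, dite_true]
      congr 1
      exact Subtype.ext hk.symm
    · simp [hk]
  right_inv y := by
    ext k
    · simp
    · have : (k : ℤ) ≠ i := by have := k.2.1; omega
      simp [this]

lemma splice_of_mem {i t : ℤ} (w : ℤ → G) (x : Set.Icc i t → G) (k : Set.Icc i t) :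
    splice i t w x k = x k := by
  simp only [splice, k.2, dite_true]

lemma splice_of_lt {i t j : ℤ} (w : ℤ → G) (x : Set.Icc i t → G) (hj : j < i) :
    splice i t w x j = w j := by
  simp only [splice, Set.mem_Icc, not_le.2 hj, false_and, dite_false]

lemma splice_wordEquiv_symm {i t : ℤ} (h : i ≤ t) (w : ℤ → G) (y : G × (Set.Icc (i + 1) t → G)) :
    splice i t w ((wordEquiv G h).symm y) = splice (i + 1) t (Function.update w i y.1) y.2 := by
  ext j
  rcases lt_trichotomy j i with hj | rfl | hj
  · rw [splice_of_lt _ _ hj, splice_of_lt _ _ (by omega), Function.update_of_ne hj.ne]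
  · rw [splice_of_lt (i := j + 1) _ _ (by omega), Function.update_self]
    simp [splice, wordEquiv, h]
  · have hj1 : i + 1 ≤ j := hj
    by_cases hjt : j ≤ t
    · simp [splice, wordEquiv, hj.le, hj1, hjt, hj.ne']
    · simp [splice, hjt, hj.ne']

lemma past_update (i : ℤ) (w : ℤ → G) (g : G) :
    past (i + 1) (Function.update w i g) = push g (past i w) := by
  rw [past_succ, Function.update_self]
  congr 1
  exact past_congr fun j hj => Function.update_of_ne hj.ne _ _

variable [MeasurableSpace G] (P : Kernel (ℕ → G) G)

lemma wordProb_eq_prod (i t : ℤ) (w : ℤ → G) (x : Set.Icc i t → G) :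
    wordProb P i t w x = ∏ k ∈ Finset.Icc i t,
      (P (past k (splice i t w x))).real {splice i t w x k} := by
  rw [Finset.prod_subtype (Finset.Icc i t) (p := fun k => k ∈ Set.Icc i t) (by simp)]
  refine Finset.prod_congr rfl fun k _ => ?_
  rw [splice_of_mem]

lemma wordProb_nonneg (i t : ℤ) (w : ℤ → G) (x : Set.Icc i t → G) : 0 ≤ wordProb P i t w x :=
  Finset.prod_nonneg fun _ _ => measureReal_nonneg

lemma wordProb_wordEquiv_symm {i t : ℤ} (h : i ≤ t) (w : ℤ → G)
    (y : G × (Set.Icc (i + 1) t → G)) :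
    wordProb P i t w ((wordEquiv G h).symm y) =
      (P (past i w)).real {y.1} * wordProb P (i + 1) t (Function.update w i y.1) y.2 := by
  rw [wordProb_eq_prod, wordProb_eq_prod, ← Finset.insert_Icc_add_one_left_eq_Icc h,
    Finset.prod_insert (by simp), splice_wordEquiv_symm]
  have hp : past i (splice (i + 1) t (Function.update w i y.1) y.2) = past i w :=
    past_congr fun j hj => by rw [splice_of_lt _ _ (by omega), Function.update_of_ne hj.ne]
  rw [hp, splice_of_lt _ _ (by omega), Function.update_self]

variable [Countable G] [DiscreteMeasurableSpace G] [IsMarkovKernel P]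

lemma hasSum_wordProb (n : ℕ) {i t : ℤ} (h : t + 1 = i + n) (w : ℤ → G) :
    HasSum (wordProb P i t w) 1 := by
  induction n generalizing i w with
  | zero =>
    have : IsEmpty (Set.Icc i t) := ⟨fun k => by have := k.2.1; have := k.2.2; omega⟩
    have h1 := hasSum_unique (wordProb P i t w)
    simpa [wordProb] using h1
  | succ n ih =>
    have hit : i ≤ t := by push_cast at h; omega
    rw [← (wordEquiv G hit).symm.hasSum_iff]
    have hf : (wordProb P i t w ∘ (wordEquiv G hit).symm) = fun y =>
        (P (past i w)).real {y.1} * wordProb P (i + 1) t (Function.update w i y.1) y.2 :=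
      funext fun y => wordProb_wordEquiv_symm P hit w y
    rw [hf]
    have hfib : ∀ g, HasSum (fun x => (P (past i w)).real {g} *
        wordProb P (i + 1) t (Function.update w i g) x) ((P (past i w)).real {g}) := fun g => by
      simpa using (ih (by push_cast at h; omega) (Function.update w i g)).mul_left _
    -- Summability over pairs must precede the fiberwise summation.
    have hs : Summable fun y : G × (Set.Icc (i + 1) t → G) =>
        (P (past i w)).real {y.1} * wordProb P (i + 1) t (Function.update w i y.1) y.2 := by
      rw [summable_prod_of_nonneg fun y => mul_nonneg measureReal_nonneg (wordProb_nonneg ..)]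
      refine ⟨fun g => (hfib g).summable, ?_⟩
      simp only [(hfib _).tsum_eq]
      exact (hasSum_real_singleton _).summable
    have := (hs.hasSum.prod_fiberwise hfib).unique (hasSum_real_singleton _)
    rw [← this]
    exact hs.hasSum

/-- Peeling off the earliest letter turns the sum over words into one application of `histOp`, with
`φ` read on the history after the whole word. -/
lemma hasSum_wordProb_mul {φ : (ℕ → G) → ℝ} {C : ℝ} (hC : ∀ w, |φ w| ≤ C) (n : ℕ) {i t : ℤ}
    (h : t + 1 = i + n) (w : ℤ → G) :
    HasSum (fun x => wordProb P i t w x * φ (past (t + 1) (splice i t w x)))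
      ((histOp P)^[n] φ (past i w)) := by
  induction n generalizing i w with
  | zero =>
    have : IsEmpty (Set.Icc i t) := ⟨fun k => by have := k.2.1; have := k.2.2; omega⟩
    have h1 := hasSum_unique fun x => wordProb P i t w x * φ (past (t + 1) (splice i t w x))
    have h2 : t + 1 = i := by simpa using h
    have h3 : splice i t w default = w := by
      ext j
      have : ¬ (i ≤ j ∧ j ≤ t) := by omega
      simp [splice, this]
    rw [h3] at h1
    simpa [wordProb, h2] using h1
  | succ n ih =>
    have hit : i ≤ t := by push_cast at h; omega
    have hs := summable_mul_of_abs_le (hasSum_wordProb P (n + 1) h w).summable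
      (wordProb_nonneg P i t w) (fun x => hC (past (t + 1) (splice i t w x)))
    have hs' := ((wordEquiv G hit).symm.hasSum_iff).2 hs.hasSum
    have hf : ((fun x => wordProb P i t w x * φ (past (t + 1) (splice i t w x))) ∘
        (wordEquiv G hit).symm) = fun y => (P (past i w)).real {y.1} *
          (wordProb P (i + 1) t (Function.update w i y.1) y.2 *
            φ (past (t + 1) (splice (i + 1) t (Function.update w i y.1) y.2))) := by
      funext y
      simp only [Function.comp, wordProb_wordEquiv_symm, splice_wordEquiv_symm, mul_assoc]
    rw [hf] at hs'
    have hfib := fun g => (ih (i := i + 1) (by push_cast at h; omega)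
      (Function.update w i g)).mul_left ((P (past i w)).real {g})
    have h1 := hs'.prod_fiberwise hfib
    simp only [past_update] at h1
    have h2 := h1.unique (hasSum_integral (P (past i w))
      (φ := fun g => (histOp P)^[n] φ (push g (past i w)))
      fun g => abs_histOp_iterate_le P hC n _)
    rw [Function.iterate_succ_apply', histOp, ← h2]
    exact hs.hasSum

end Words

/-! ### Compatible measures and conditional expectations. -/

section Compatible

variable {G : Type*} [MeasurableSpace G]

lemma measurable_past (i : ℤ) : Measurable (past (G := G) i) :=
  measurable_pi_lambda _ fun _ => measurable_pi_apply _

lemma pastSigma_le (i : ℤ) : pastSigma G i ≤ MeasurableSpace.pi := (measurable_past i).comap_le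

lemma pastSigma_le_succ (i : ℤ) : pastSigma G i ≤ pastSigma G (i + 1) := by
  have h : past (G := G) i = (fun w m => w (m + 1)) ∘ past (i + 1) := by
    ext η m
    simp [past_succ, push]
  rw [pastSigma, h, ← MeasurableSpace.comap_comp]
  exact MeasurableSpace.comap_mono (Measurable.comap_le (by fun_prop))

variable [Countable G] [DiscreteMeasurableSpace G] {P : Kernel (ℕ → G) G}

lemma measurable_prob (g : G) : Measurable fun w => (P w).real {g} :=
  (P.measurable_coe (MeasurableSet.singleton g)).ennreal_toReal

variable [IsMarkovKernel P]

/-- Conditional expectations are determined by integrals over the generating events `past i ⁻¹' s`.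
This form serves both to exploit compatibility and to verify it for `muPhi`. -/
lemma isCompatible_iff {μ : Measure (ℤ → G)} [IsProbabilityMeasure μ] :
    IsCompatible P μ ↔ ∀ (i : ℤ) (g : G) (s : Set (ℕ → G)), MeasurableSet s →
      μ.real (past i ⁻¹' s ∩ {η | η i = g}) = ∫ w in s, (P w).real {g} ∂(μ.map (past i)) := by
  have hmeas : ∀ (i : ℤ) (g : G), MeasurableSet {η : ℤ → G | η i = g} := fun i g =>
    show MeasurableSet ((fun η : ℤ → G => η i) ⁻¹' {g}) from
      (measurable_pi_apply i) (MeasurableSet.singleton g)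
  have hint : ∀ (i : ℤ) (g : G), Integrable
      (Set.indicator {η : ℤ → G | η i = g} fun _ => (1 : ℝ)) μ := fun i g =>
    (integrable_const 1).indicator (hmeas i g)
  have hleft : ∀ (i : ℤ) (g : G) (s : Set (ℕ → G)), MeasurableSet s →
      ∫ η in past i ⁻¹' s, Set.indicator {η : ℤ → G | η i = g} (fun _ => (1 : ℝ)) η ∂μ =
        μ.real (past i ⁻¹' s ∩ {η | η i = g}) := by
    intro i g s hs
    rw [setIntegral_indicator (hmeas i g)]
    simp
  have hright : ∀ (i : ℤ) (g : G) (s : Set (ℕ → G)), MeasurableSet s →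
      ∫ η in past i ⁻¹' s, (P (past i η)).real {g} ∂μ =
        ∫ w in s, (P w).real {g} ∂(μ.map (past i)) := fun i g s hs =>
    (setIntegral_map hs (measurable_prob g).aestronglyMeasurable
      (measurable_past i).aemeasurable).symm
  constructor
  · rintro ⟨-, h⟩ i g s hs
    have hs' : MeasurableSet[pastSigma G i] (past i ⁻¹' s) := ⟨s, hs, rfl⟩
    rw [← hleft i g s hs, ← hright i g s hs, ← setIntegral_condExp (pastSigma_le i) (hint i g) hs']
    exact setIntegral_congr_ae (pastSigma_le i _ hs') ((h i g).mono fun x hx _ => hx)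
  · refine fun h => ⟨inferInstance, fun i g => ?_⟩
    have hb : Integrable (fun η : ℤ → G => (P (past i η)).real {g}) μ :=
      integrable_of_abs_le ((measurable_prob g).comp (measurable_past i)) (C := 1) fun η => by
        rw [abs_of_nonneg measureReal_nonneg]
        exact measureReal_le_one
    refine (ae_eq_condExp_of_forall_setIntegral_eq (pastSigma_le i) (hint i g)
      (fun s _ _ => hb.integrableOn) ?_ ?_).symm
    · rintro _ ⟨s, hs, rfl⟩ -
      rw [hleft i g s hs, hright i g s hs, h i g s hs]
    · exact ((measurable_prob g).comp
        (comap_measurable (past i))).stronglyMeasurable.aestronglyMeasurable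

/-- Measures on `X × G` with `G` countable are determined by the sets `s × {g}`. -/
lemma measure_ext_prod_singleton {X : Type*} [MeasurableSpace X] {ν ν' : Measure (X × G)}
    (h : ∀ (s : Set X) (g : G), MeasurableSet s → ν (s ×ˢ {g}) = ν' (s ×ˢ {g})) : ν = ν' := by
  ext C hC
  have hCg : ∀ g, MeasurableSet ((fun x => (x, g)) ⁻¹' C) := fun g =>
    (measurable_id.prodMk measurable_const) hC
  have hu : C = ⋃ g : G, ((fun x => (x, g)) ⁻¹' C) ×ˢ {g} := by
    ext ⟨x, g⟩
    simp
  have hd : Pairwise (Function.onFun Disjoint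
      fun g : G => ((fun x => (x, g)) ⁻¹' C) ×ˢ ({g} : Set G)) := by
    intro g g' hg
    exact Set.disjoint_prod.2 (Or.inr (by simpa using hg))
  have hm : ∀ g : G, MeasurableSet (((fun x => (x, g)) ⁻¹' C) ×ˢ ({g} : Set G)) := fun g =>
    (hCg g).prod (MeasurableSet.singleton g)
  rw [hu, measure_iUnion hd hm, measure_iUnion hd hm]
  exact tsum_congr fun g => h _ g (hCg g)

variable {μ : Measure (ℤ → G)}

lemma IsCompatible.map_eq_compProd (hμ : IsCompatible P μ) (i : ℤ) :
    μ.map (fun η => (past i η, η i)) = (μ.map (past i)) ⊗ₘ P := by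
  have := hμ.1
  have : IsProbabilityMeasure (μ.map (past i)) :=
    Measure.isProbabilityMeasure_map (measurable_past i).aemeasurable
  refine measure_ext_prod_singleton fun s g hs => ?_
  have h := isCompatible_iff.1 hμ i g s hs
  rw [Measure.map_apply ((measurable_past i).prodMk (measurable_pi_apply i))
    (hs.prod (MeasurableSet.singleton g)),
    Measure.compProd_apply_prod hs (MeasurableSet.singleton g)]
  have h2 : ∫ w in s, (P w).real {g} ∂(μ.map (past i)) =
      (∫⁻ w in s, P w {g} ∂(μ.map (past i))).toReal :=
    integral_toReal (P.measurable_coe (MeasurableSet.singleton g)).aemeasurable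
      (Eventually.of_forall fun w => measure_lt_top _ _)
  rw [h2, measureReal_def, ENNReal.toReal_eq_toReal_iff' (measure_ne_top _ _)] at h
  · exact h
  · rw [← Measure.compProd_apply_prod hs (MeasurableSet.singleton g)]
    exact measure_ne_top _ _

/-- The next history is the present letter pushed onto the past, and their joint law is a
composition product with `P`. -/
lemma IsCompatible.condExp_past_succ (hμ : IsCompatible P μ) (i : ℤ) {φ : (ℕ → G) → ℝ}
    (hφ : Measurable φ) {C : ℝ} (hC : ∀ w, |φ w| ≤ C) :
    μ[fun η => φ (past (i + 1) η) | pastSigma G i] =ᵐ[μ] fun η => histOp P φ (past i η) := by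
  have := hμ.1
  have : IsProbabilityMeasure (μ.map (past i)) :=
    Measure.isProbabilityMeasure_map (measurable_past i).aemeasurable
  have hT := measurable_histOp P hφ
  have hTC : ∀ w, |histOp P φ w| ≤ C := fun w => abs_integral_le_of_abs_le fun _ => hC _
  refine (ae_eq_condExp_of_forall_setIntegral_eq (pastSigma_le i)
    (integrable_of_abs_le (hφ.comp (measurable_past _)) fun _ => hC _)
    (fun s _ _ => (integrable_of_abs_le (hT.comp (measurable_past i))
      fun _ => hTC _).integrableOn) ?_ ?_).symm
  · rintro _ ⟨s, hs, rfl⟩ -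
    have hψ : Measurable fun x : (ℕ → G) × G => φ (push x.2 x.1) :=
      hφ.comp (measurable_push_prod.comp measurable_swap)
    have hpair : Measurable fun η : ℤ → G => (past i η, η i) :=
      (measurable_past i).prodMk (measurable_pi_apply i)
    have h1 := Measure.setIntegral_compProd (μ := μ.map (past i)) (κ := P) hs MeasurableSet.univ
      (integrable_of_abs_le hψ (ν := (μ.map (past i)) ⊗ₘ P) (fun _ => hC _)).integrableOn
    rw [← hμ.map_eq_compProd i, setIntegral_map (hs.prod MeasurableSet.univ)
      hψ.aestronglyMeasurable hpair.aemeasurable] at h1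
    simp only [Measure.restrict_univ, ← past_succ] at h1
    rw [show (fun η : ℤ → G => (past i η, η i)) ⁻¹' (s ×ˢ Set.univ) = past i ⁻¹' s by
      ext; simp] at h1
    exact (setIntegral_map hs hT.aestronglyMeasurable
      (measurable_past i).aemeasurable).symm.trans h1.symm
  · exact (hT.comp (comap_measurable (past i))).stronglyMeasurable.aestronglyMeasurable

lemma measurable_histOp_iterate {φ : (ℕ → G) → ℝ} (hφ : Measurable φ) (n : ℕ) :
    Measurable ((histOp P)^[n] φ) := by
  induction n with
  | zero => exact hφ
  | succ n ih =>
    rw [Function.iterate_succ_apply']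
    exact measurable_histOp P ih

/-- Tower property: condition first on the past of `i + 1`, then on that of `i`. -/
lemma IsCompatible.condExp_past_add (hμ : IsCompatible P μ) {φ : (ℕ → G) → ℝ}
    (hφ : Measurable φ) {C : ℝ} (hC : ∀ w, |φ w| ≤ C) (n : ℕ) {i t : ℤ} (h : t = i + n) :
    μ[fun η => φ (past t η) | pastSigma G i] =ᵐ[μ] fun η => (histOp P)^[n] φ (past i η) := by
  have := hμ.1
  induction n generalizing i with
  | zero =>
    obtain rfl : t = i := by simpa using h
    rw [condExp_of_stronglyMeasurable (f := fun η => φ (past t η)) (pastSigma_le t)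
      (hφ.comp (comap_measurable (past t))).stronglyMeasurable
      (integrable_of_abs_le (hφ.comp (measurable_past t)) fun _ => hC _)]
    rfl
  | succ n ih =>
    have h1 := ih (i := i + 1) (by push_cast at h; omega)
    have h2 := condExp_condExp_of_le (μ := μ) (f := fun η => φ (past t η))
      (pastSigma_le_succ (G := G) i) (pastSigma_le (i + 1))
    simp only [Function.iterate_succ_apply']
    exact (h2.symm.trans (condExp_congr_ae h1)).trans
      (hμ.condExp_past_succ i (measurable_histOp_iterate hφ n) (abs_histOp_iterate_le P hC n))

end Compatible

/-! ### Loss of memory and uniqueness. -/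

section LossOfMemory

variable {G : Type*} {s t : ℤ} {f : (ℤ → G) → ℝ}

/-- A function of the coordinates up to time `t`, as a function of the history before `t + 1`. -/
def onHistory (t : ℤ) (f : (ℤ → G) → ℝ) (w : ℕ → G) : ℝ := f fun j => w (t - j).toNat

lemma onHistory_past (hf : DependsOn f (Set.Icc s t)) (η : ℤ → G) :
    onHistory t f (past (t + 1) η) = f η := by
  refine hf fun j hj => ?_
  have := hj.2
  simp only [past]
  congr 1
  omega

lemma onHistory_congr (hf : DependsOn f (Set.Icc s t)) {w v : ℕ → G}
    (h : ∀ m < (t - s).toNat + 1, w m = v m) : onHistory t f w = onHistory t f v :=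
  hf fun j hj => h _ (by have := hj.1; omega)

variable [Countable G] [MeasurableSpace G] [DiscreteMeasurableSpace G]
  (P : Kernel (ℕ → G) G) [IsMarkovKernel P] {C : ℝ} {i : ℤ}

lemma condMean_eq_iterate (hf : DependsOn f (Set.Icc s t)) (hC : ∀ η, |f η| ≤ C)
    (hi : i ≤ t + 1) (w : ℤ → G) :
    condMean P i t f w = (histOp P)^[(t + 1 - i).toNat] (onHistory t f) (past i w) := by
  rw [← (hasSum_wordProb_mul P (φ := onHistory t f) (fun _ => hC _) (t + 1 - i).toNat (t := t)
    (by omega) w).tsum_eq, condMean]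
  simp only [onHistory_past hf]

lemma abs_condMean_sub_le (hf : DependsOn f (Set.Icc s t)) (hC : ∀ η, |f η| ≤ C)
    (hst : s ≤ t) (his : i ≤ s) (w v : ℤ → G) :
    |condMean P i t f w - condMean P i t f v| ≤ 2 * C *
      ∑ j ∈ Finset.range ((t - s).toNat + 1), rho (aSeq P) ((s - i).toNat + j) := by
  have hC0 : 0 ≤ C := (abs_nonneg _).trans (hC w)
  rw [condMean_eq_iterate P hf hC (by omega), condMean_eq_iterate P hf hC (by omega)]
  refine (abs_histOp_iterate_sub_le P (fun _ => hC _) (L := (t - s).toNat + 1) (by omega)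
    (fun _ _ h => onHistory_congr hf h) _ _).trans ?_
  refine mul_le_mul_of_nonneg_left ?_ (by linarith)
  -- After reversal the indices are `(s - i) + j + 1`, one larger than those stated; monotonicity of
  -- `ρ` absorbs the difference.
  rw [← Finset.sum_range_reflect]
  refine Finset.sum_le_sum fun j hj => rho_antitone (aSeq_mem_Icc P) (aSeq_mono P) ?_
  have := Finset.mem_range.1 hj
  omega

variable {P} {μ ν : Measure (ℤ → G)}

lemma IsCompatible.condExp_eq_condMean (hμ : IsCompatible P μ) (hf : DependsOn f (Set.Icc s t))
    (hC : ∀ η, |f η| ≤ C) (hi : i ≤ t + 1) :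
    μ[f | pastSigma G i] =ᵐ[μ] condMean P i t f := by
  have h := hμ.condExp_past_add (measurable_of_agree _ fun _ _ h => onHistory_congr hf h)
    (fun _ => hC _) (t + 1 - i).toNat (i := i) (t := t + 1) (by omega)
  simp only [onHistory_past hf, ← condMean_eq_iterate P hf hC hi] at h
  exact h

/-- The expectation of `f` is the `μ`-average of `condMean` over all pasts, each within the bound of
the value at `w`. -/
lemma IsCompatible.abs_integral_sub_le (hμ : IsCompatible P μ) (hf : DependsOn f (Set.Icc s t))
    (hC : ∀ η, |f η| ≤ C) (hst : s ≤ t) (his : i ≤ s) (w : ℤ → G) :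
    |∫ η, f η ∂μ - condMean P i t f w| ≤ 2 * C *
      ∑ j ∈ Finset.range ((t - s).toNat + 1), rho (aSeq P) ((s - i).toNat + j) := by
  have := hμ.1
  have h := hμ.condExp_eq_condMean hf hC (i := i) (by omega)
  have hint : Integrable (condMean P i t f) μ := integrable_condExp.congr h
  have hc : condMean P i t f w = ∫ _, condMean P i t f w ∂μ := by simp
  rw [← integral_condExp (pastSigma_le i), integral_congr_ae h, hc,
    ← integral_sub hint (integrable_const _)]
  exact abs_integral_le_of_abs_le fun η => abs_condMean_sub_le P hf hC hst his η w

lemma IsCompatible.unique (hμ : IsCompatible P μ) (hν : IsCompatible P ν)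
    (hρ : Tendsto (rho (aSeq P)) atTop (nhds 0)) : μ = ν := by
  have := hμ.1
  have := hν.1
  obtain ⟨w⟩ : Nonempty (ℤ → G) := nonempty_of_isProbabilityMeasure μ
  have key : ∀ (f : (ℤ → G) → ℝ) (s t : ℤ), s ≤ t → DependsOn f (Set.Icc s t) →
      (∀ η, |f η| ≤ 1) → ∫ η, f η ∂μ = ∫ η, f η ∂ν := by
    intro f s t hst hf h1
    have hlim : Tendsto (fun n => 2 * (2 * 1 *
        ∑ j ∈ Finset.range ((t - s).toNat + 1), rho (aSeq P) (n + j))) atTop (nhds 0) := by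
      have h2 := tendsto_finsetSum (Finset.range ((t - s).toNat + 1)) fun j _ =>
        hρ.comp (tendsto_add_atTop_nat j)
      simpa only [Function.comp_def, Finset.sum_const_zero, mul_zero] using
        (h2.const_mul (2 * 1)).const_mul 2
    have hle : |∫ η, f η ∂μ - ∫ η, f η ∂ν| ≤ 0 := by
      refine ge_of_tendsto' hlim fun n => ?_
      have h3 := hμ.abs_integral_sub_le hf h1 hst (i := s - n) (by omega) w
      have h4 := hν.abs_integral_sub_le hf h1 hst (i := s - n) (by omega) w
      have hn : (s - (s - n : ℤ)).toNat = n := by omega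
      rw [hn] at h3 h4
      rw [abs_sub_comm] at h4
      have := abs_sub_le (∫ η, f η ∂μ) (condMean P (s - n) t f w) (∫ η, f η ∂ν)
      linarith
    exact sub_eq_zero.1 (abs_nonpos_iff.1 hle)
  refine IsProjectiveLimit.unique (P := fun I : Finset ℤ => ν.map I.restrict) (fun I => ?_)
    fun I => rfl
  have hr : Measurable (I.restrict : (ℤ → G) → _) := Finset.measurable_restrict I
  have : IsProbabilityMeasure (μ.map I.restrict) :=
    Measure.isProbabilityMeasure_map hr.aemeasurable
  have : IsProbabilityMeasure (ν.map I.restrict) :=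
    Measure.isProbabilityMeasure_map hr.aemeasurable
  ext A hA
  rw [← ENNReal.toReal_eq_toReal_iff' (measure_ne_top _ _) (measure_ne_top _ _),
    Measure.map_apply hr hA, Measure.map_apply hr hA]
  -- A sum rather than a maximum, so that the empty `I` needs no separate treatment.
  set N : ℤ := ∑ i ∈ I, |i|
  have hN : ∀ i ∈ I, i ∈ Set.Icc (-N) N := fun i hi =>
    abs_le.1 (Finset.single_le_sum (f := fun i : ℤ => |i|) (fun j _ => abs_nonneg j) hi)
  have hN0 : 0 ≤ N := Finset.sum_nonneg fun j _ => abs_nonneg j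
  have h := key (Set.indicator (I.restrict ⁻¹' A) fun _ => 1) (-N) N (by omega) ?_ ?_
  · rw [integral_indicator (hr hA), integral_indicator (hr hA)] at h
    simpa [measureReal_def] using h
  · intro η ζ h
    have hA' : η ∈ I.restrict ⁻¹' A ↔ ζ ∈ I.restrict ⁻¹' A :=
      iff_of_eq (congrArg (· ∈ A) (funext fun j => h j (hN j j.2)))
    by_cases hη : η ∈ I.restrict ⁻¹' A
    · rw [Set.indicator_of_mem hη, Set.indicator_of_mem (hA'.1 hη)]
    · rw [Set.indicator_of_notMem hη, Set.indicator_of_notMem (mt hA'.2 hη)]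
  · intro η
    simp only [Set.indicator]
    split_ifs <;> simp

end LossOfMemory

/-! ### Series summed along an enumeration of the alphabet. -/

section Enumeration

variable {G : Type*} {e : G → ℕ} {b : G → ℝ}

/-- `Function.extend e b 0` puts `0` at unused codes, so an injective `e` with gaps still reduces to
partial sums over `ℕ`. -/
lemma tsum_enum_lt (he : Function.Injective e) (N : ℕ) :
    ∑' g' : {g' : G // e g' < N}, b g' = ∑ n ∈ Finset.range N, Function.extend e b 0 n := by
  have h1 := tsum_subtype {g' | e g' < N} b
  refine h1.trans (HasSum.tsum_eq ?_)
  rw [← hasSum_extend_zero he]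
  have h2 : Function.extend e (Set.indicator {g' | e g' < N} b) 0 =
      Set.indicator (Set.Iio N) (Function.extend e b 0) := by
    ext n
    by_cases hn : ∃ g, e g = n
    · obtain ⟨g, rfl⟩ := hn
      simp [he.extend_apply, Set.indicator]
    · simp [Function.extend_apply' _ _ _ hn, Set.indicator]
  rw [h2]
  have h3 : HasSum (Set.indicator (Set.Iio N) (Function.extend e b 0))
      (∑ n ∈ Finset.range N, Set.indicator (Set.Iio N) (Function.extend e b 0) n) :=
    hasSum_sum_of_ne_finset_zero fun n hn =>
      Set.indicator_of_notMem (by simpa using hn) _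
  convert h3 using 1
  refine Finset.sum_congr rfl fun n hn => ?_
  simp [Set.indicator, Finset.mem_range.1 hn]

lemma extend_zero_nonneg (he : Function.Injective e) (hb : ∀ g, 0 ≤ b g) (n : ℕ) :
    0 ≤ Function.extend e b 0 n := by
  by_cases hn : ∃ g, e g = n
  · obtain ⟨g, rfl⟩ := hn
    rw [he.extend_apply]
    exact hb g
  · rw [Function.extend_apply' _ _ _ hn]
    exact le_rfl

lemma tsum_enum_lt_add_le (he : Function.Injective e) (hb : ∀ g, 0 ≤ b g) {g : G} {N : ℕ}
    (hg : e g < N) :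
    ∑' g' : {g' : G // e g' < e g}, b g' + b g ≤ ∑' g' : {g' : G // e g' < N}, b g' := by
  have h1 : ∑' g' : {g' : G // e g' < e g}, b g' + b g =
      ∑ n ∈ Finset.range (e g + 1), Function.extend e b 0 n := by
    rw [tsum_enum_lt he, Finset.sum_range_succ, he.extend_apply]
  rw [h1, tsum_enum_lt he]
  exact Finset.sum_le_sum_of_subset_of_nonneg (Finset.range_subset_range.2 hg)
    fun n _ _ => extend_zero_nonneg he hb n

lemma tsum_enum_lt_le (hb : ∀ g, 0 ≤ b g) (hs : Summable b) (N : ℕ) :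
    ∑' g' : {g' : G // e g' < N}, b g' ≤ ∑' g, b g :=
  hs.tsum_subtype_le b _ hb

lemma exists_enum_mem_Ico (he : Function.Injective e) (hs : Summable b) {y : ℝ} (hy0 : 0 ≤ y)
    (hy : y < ∑' g, b g) :
    ∃ g, ∑' g' : {g' : G // e g' < e g}, b g' ≤ y ∧
      y < ∑' g' : {g' : G // e g' < e g}, b g' + b g := by
  classical
  have h1 := ((hasSum_extend_zero he).2 hs.hasSum).tendsto_sum_nat
  have h2 : ∃ N, y < ∑ n ∈ Finset.range N, Function.extend e b 0 n :=
    (h1.eventually_const_lt hy).exists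
  have h3 := Nat.find_spec h2
  obtain ⟨N, hN⟩ : ∃ N, Nat.find h2 = N + 1 := by
    refine Nat.exists_eq_succ_of_ne_zero fun h0 => ?_
    rw [h0, Finset.sum_range_zero] at h3
    linarith
  have h4 : ∑ n ∈ Finset.range N, Function.extend e b 0 n ≤ y :=
    not_lt.1 (Nat.find_min h2 (by omega))
  rw [hN, Finset.sum_range_succ] at h3
  obtain ⟨g, rfl⟩ : ∃ g, e g = N := by
    by_contra hn
    rw [Function.extend_apply' _ _ _ hn, Pi.zero_apply] at h3
    linarith
  rw [he.extend_apply] at h3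
  exact ⟨g, by rwa [tsum_enum_lt he], by rwa [tsum_enum_lt he]⟩

end Enumeration

/-! ### The partition of `[0, 1)` into the intervals `B_k(g | w)`. -/

section Intervals

variable {G : Type*} [MeasurableSpace G] (P : Kernel (ℕ → G) G)

lemma aPrev_zero (g : G) (w : ℕ → G) : aPrev P 0 g w = 0 := by simp [aPrev]

lemma aPrev_succ (k : ℕ) (g : G) (w : ℕ → G) : aPrev P (k + 1) g w = aWord P k g w := by
  simp [aPrev]

lemma aPrev_congr {k : ℕ} {w v : ℕ → G} (h : ∀ m < k, w m = v m) (g : G) :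
    aPrev P k g w = aPrev P k g v := by
  cases k with
  | zero => simp only [aPrev_zero]
  | succ k =>
    simp only [aPrev_succ]
    exact aWord_congr P (fun m hm => h m (by omega)) g

lemma bWord_congr {k : ℕ} {w v : ℕ → G} (h : ∀ m < k, w m = v m) (g : G) :
    bWord P k g w = bWord P k g v := by
  rw [bWord, bWord, aPrev_congr P h, aWord_congr P h]

lemma interval_congr (e : G → ℕ) {k : ℕ} {w v : ℕ → G} (h : ∀ m < k, w m = v m) (g : G) :
    interval P e k g w = interval P e k g v := by
  simp only [interval, leftEnd, aPrev_congr P h, bWord_congr P h]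

lemma bWord_nonneg (k : ℕ) (g : G) (w : ℕ → G) : 0 ≤ bWord P k g w := by
  rw [bWord, sub_nonneg]
  cases k with
  | zero => rw [aPrev_zero]; exact aWord_nonneg P 0 g w
  | succ k => rw [aPrev_succ]; exact aWord_mono P g w (Nat.le_succ k)

lemma sum_bWord (n : ℕ) (g : G) (w : ℕ → G) :
    ∑ k ∈ Finset.range (n + 1), bWord P k g w = aWord P n g w := by
  induction n with
  | zero => simp [bWord, aPrev_zero]
  | succ n ih => rw [Finset.sum_range_succ, ih, bWord, aPrev_succ]; ring

lemma leftEnd_nonneg (e : G → ℕ) (k : ℕ) (g : G) (w : ℕ → G) : 0 ≤ leftEnd P e k g w := by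
  refine add_nonneg (tsum_nonneg fun g => ?_) (tsum_nonneg fun g => bWord_nonneg P _ _ _)
  cases k with
  | zero => rw [aPrev_zero]
  | succ k => rw [aPrev_succ]; exact aWord_nonneg P _ _ _

variable [Countable G] [DiscreteMeasurableSpace G] [IsMarkovKernel P]

lemma summable_aPrev (k : ℕ) (w : ℕ → G) : Summable fun g => aPrev P k g w := by
  cases k with
  | zero => simpa only [aPrev_zero] using summable_zero
  | succ k => simpa only [aPrev_succ] using summable_aWord P k w

lemma summable_bWord (k : ℕ) (w : ℕ → G) : Summable fun g => bWord P k g w :=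
  (summable_aWord P k w).sub (summable_aPrev P k w)

lemma tsum_aPrev_add_tsum_bWord (k : ℕ) (w : ℕ → G) :
    ∑' g, aPrev P k g w + ∑' g, bWord P k g w = ∑' g, aWord P k g w := by
  rw [← (summable_aPrev P k w).tsum_add (summable_bWord P k w)]
  exact tsum_congr fun g => by rw [bWord]; ring

lemma tsum_aWord_le_tsum_aPrev {k l : ℕ} (h : k < l) (w : ℕ → G) :
    ∑' g, aWord P k g w ≤ ∑' g, aPrev P l g w := by
  cases l with
  | zero => omega
  | succ l =>
    simp only [aPrev_succ]
    exact tsum_aWord_mono P w (by omega)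

/-- The deficits `P(g | w) - a_k(g | w)` are nonnegative with sum at most `1 - a_k`, so each one is
at most `1 - a_k`. -/
lemma tendsto_aWord (ha : Tendsto (aSeq P) atTop (nhds 1)) (g : G) (w : ℕ → G) :
    Tendsto (fun k => aWord P k g w) atTop (nhds ((P w).real {g})) := by
  have h1 : Tendsto (fun k => (P w).real {g} - (1 - aSeq P k)) atTop (nhds ((P w).real {g})) := by
    simpa using (ha.const_sub 1).const_sub ((P w).real {g})
  refine tendsto_of_tendsto_of_tendsto_of_le_of_le h1 tendsto_const_nhds (fun k => ?_)
    fun k => aWord_le P k g w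
  have h2 := (hasSum_real_singleton (P w)).sub (summable_aWord P k w).hasSum
  have h3 := le_hasSum h2 g fun g' _ => sub_nonneg.2 (aWord_le P k g' w)
  have h4 := aSeq_le P k w
  simp only
  linarith

variable {e : G → ℕ} (he : Function.Injective e)
include he

lemma leftEnd_add_le (k : ℕ) (g : G) (w : ℕ → G) :
    leftEnd P e k g w + bWord P k g w ≤ ∑' g, aWord P k g w := by
  have h1 := tsum_enum_lt_add_le he (fun g => bWord_nonneg P k g w) (Nat.lt_succ_self (e g))
  have h2 := tsum_enum_lt_le (e := e) (fun g => bWord_nonneg P k g w) (summable_bWord P k w)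
    (e g + 1)
  have h3 := tsum_aPrev_add_tsum_bWord P k w
  rw [leftEnd]
  linarith

lemma interval_subset (k : ℕ) (g : G) (w : ℕ → G) : interval P e k g w ⊆ Set.Ico 0 1 :=
  Set.Ico_subset_Ico (leftEnd_nonneg P e k g w)
    ((leftEnd_add_le P he k g w).trans (tsum_aWord_le_one P k w))

lemma eq_of_mem_interval {x : ℝ} {w : ℕ → G} {k k' : ℕ} {g g' : G}
    (h : x ∈ interval P e k g w) (h' : x ∈ interval P e k' g' w) : k = k' ∧ g = g' := by
  have hk : ∀ {k k' : ℕ} {g g' : G}, x ∈ interval P e k g w → x ∈ interval P e k' g' w →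
      ¬ k < k' := by
    intro k k' g g' h h' hlt
    have h1 := leftEnd_add_le P he k g w
    have h2 := tsum_aWord_le_tsum_aPrev P hlt w
    have h3 : ∑' g, aPrev P k' g w ≤ leftEnd P e k' g' w :=
      le_add_of_nonneg_right (tsum_nonneg fun g => bWord_nonneg P _ _ _)
    linarith [h.2, h'.1]
  obtain rfl : k = k' := le_antisymm (not_lt.1 (hk h' h)) (not_lt.1 (hk h h'))
  have hg : ∀ {g g' : G}, x ∈ interval P e k g w → x ∈ interval P e k g' w →
      ¬ e g < e g' := by
    intro g g' h h' hlt
    have h1 := tsum_enum_lt_add_le he (fun g => bWord_nonneg P k g w) hlt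
    have h2 := h.2
    have h3 := h'.1
    simp only [leftEnd] at h2 h3
    linarith
  exact ⟨rfl, he (le_antisymm (not_lt.1 (hg h' h)) (not_lt.1 (hg h h')))⟩

/-- The level is the first `k` at which `∑ a_k(g | w)` exceeds `x`; within it the letter is found by
first crossing along the enumeration. -/
lemma exists_mem_interval {x : ℝ} (hx : 0 ≤ x) {m : ℕ} {w : ℕ → G}
    (hm : x < ∑' g, aWord P m g w) : ∃ g, ∃ l ≤ m, x ∈ interval P e l g w := by
  classical
  have hex : ∃ k, x < ∑' g, aWord P k g w := ⟨m, hm⟩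
  have h1 := Nat.find_spec hex
  have h2 : ∑' g, aPrev P (Nat.find hex) g w ≤ x := by
    cases hk : Nat.find hex with
    | zero => simpa [aPrev_zero] using hx
    | succ k =>
      simp only [aPrev_succ]
      exact not_lt.1 (Nat.find_min hex (by omega))
  rw [← tsum_aPrev_add_tsum_bWord] at h1
  obtain ⟨g, hg1, hg2⟩ := exists_enum_mem_Ico he (summable_bWord P (Nat.find hex) w)
    (sub_nonneg.2 h2) (by linarith)
  refine ⟨g, Nat.find hex, Nat.find_min' hex hm, ?_, ?_⟩
  · rw [leftEnd]; linarith
  · rw [leftEnd]; linarith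

/-- The levels up to `m` already cover `[0, a_m)`, and all intervals are disjoint, so the
restriction `l ≤ m` can be dropped. -/
lemma symbol_eq_iff {m : ℕ} {x : ℝ} (hx : x ∈ Set.Ico 0 (aSeq P m)) (g₀ g : G) (w : ℕ → G) :
    symbol P e g₀ m x w = g ↔ ∃ l, x ∈ interval P e l g w := by
  obtain ⟨g', l', hl', hg'⟩ := exists_mem_interval P he hx.1 (hx.2.trans_le (aSeq_le P m w))
  have hex : ∃ g : G, ∃ l ≤ m, x ∈ Set.Ico 0 (aSeq P m) ∩ interval P e l g w :=
    ⟨g', l', hl', hx, hg'⟩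
  have hs : symbol P e g₀ m x w = g' := by
    rw [symbol, dif_pos hex]
    obtain ⟨l, _, _, h⟩ := hex.choose_spec
    exact (eq_of_mem_interval P he h hg').2
  rw [hs]
  constructor
  · rintro rfl
    exact ⟨l', hg'⟩
  · rintro ⟨l, hl⟩
    exact (eq_of_mem_interval P he hg' hl).2

/-- Symbols computed at different depths from histories that agree up to the smaller depth
coincide. -/
lemma symbol_eq_symbol {m m' : ℕ} (hm : m' ≤ m) {x : ℝ} (hx : x ∈ Set.Ico 0 (aSeq P m'))
    (g₀ : G) {w w' : ℕ → G} (hw : ∀ k < m', w k = w' k) :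
    symbol P e g₀ m x w = symbol P e g₀ m' x w' := by
  rw [symbol_eq_iff P he ⟨hx.1, hx.2.trans_le (aSeq_mono P hm)⟩]
  obtain ⟨g, l, hl, hg⟩ := exists_mem_interval P he hx.1 (hx.2.trans_le (aSeq_le P m' w'))
  rw [(symbol_eq_iff P he hx g₀ g w').2 ⟨l, hg⟩]
  -- Here `l ≤ m'`, so the interval sees only entries on which the histories agree.
  exact ⟨l, by rwa [interval_congr P e (fun k hk => hw k (by omega))]⟩

/-- The lengths telescope to `a_k(g | w)`, which tends to `P(g | w)`. -/
lemma volume_iUnion_interval (ha : Tendsto (aSeq P) atTop (nhds 1)) (g : G) (w : ℕ → G) :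
    volume (⋃ l, interval P e l g w) = P w {g} := by
  rw [measure_iUnion (fun l l' h => Set.disjoint_left.2 fun x hx hx' =>
    h (eq_of_mem_interval P he hx hx').1) fun l => measurableSet_Ico]
  have h1 : HasSum (fun l => bWord P l g w) ((P w).real {g}) := by
    rw [hasSum_iff_tendsto_nat_of_nonneg fun l => bWord_nonneg P l g w,
      ← tendsto_add_atTop_iff_nat 1]
    simpa only [sum_bWord] using tendsto_aWord P ha g w
  simp only [interval, Real.volume_Ico, add_sub_cancel_left]
  rw [← ENNReal.ofReal_tsum_of_nonneg (fun l => bWord_nonneg P l g w) h1.summable, h1.tsum_eq,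
    ofReal_measureReal]

lemma unif_iUnion_interval (ha : Tendsto (aSeq P) atTop (nhds 1)) (g : G) (w : ℕ → G) :
    unif {x | ∃ l, (x : ℝ) ∈ interval P e l g w} = P w {g} := by
  rw [unif, (MeasurableEmbedding.subtype_coe measurableSet_Ico).comap_apply,
    ← volume_iUnion_interval P he ha g w]
  congr 1
  ext x
  simp only [Set.mem_image, Set.mem_ofPred_eq, Subtype.exists, exists_and_left, exists_prop,
    exists_eq_right_right, Set.mem_iUnion]
  exact ⟨fun h => h.1, fun h => ⟨h, let ⟨l, hl⟩ := h; interval_subset P he l g w hl⟩⟩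

end Intervals

/-! ### Consistency and measurability of `Φ`. -/

section Coupling

variable {G : Type*} [MeasurableSpace G] (P : Kernel (ℕ → G) G) (e : G → ℕ) (g₀ : G)

lemma bddAbove_regenSet (u : Omega) (n : ℤ) : BddAbove (regenSet P u n) := ⟨n, fun _ hs => hs.1⟩

lemma mem_regenSet_of_le {u : Omega} {s j n : ℤ} (hs : s ∈ regenSet P u n) (hsj : s ≤ j)
    (hjn : j ≤ n) : s ∈ regenSet P u j :=
  ⟨hsj, fun k hk => hs.2 k ⟨hk.1, hk.2.trans hjn⟩⟩

lemma builtPast_apply (u : Omega) (s : ℤ) {m k : ℕ} (hk : k < m) :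
    builtPast P e g₀ u s m k = builtSymbol P e g₀ u s (m - 1 - k) := by
  induction m generalizing k with
  | zero => omega
  | succ m ih =>
    cases k with
    | zero => rfl
    | succ k =>
      rw [builtPast, push, ih (by omega)]
      congr 1
      omega

lemma regenSet_congr {u v : Omega} {n : ℤ} (h : ∀ j ≤ n, u j = v j) :
    regenSet P u n = regenSet P v n := by
  ext s
  simp only [regenSet, Set.mem_ofPred_eq]
  refine and_congr_right fun _ => forall₂_congr fun j hj => ?_
  rw [h j hj.2]

lemma builtPast_congr {u v : Omega} {s : ℤ} {m : ℕ} (h : ∀ j < s + m, u j = v j) :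
    builtPast P e g₀ u s m = builtPast P e g₀ v s m := by
  induction m with
  | zero => rfl
  | succ m ih =>
    push_cast at h
    rw [builtPast, builtPast, ih fun j hj => h j (by omega), h (s + m) (by omega)]

lemma builtSymbol_congr {u v : Omega} {s : ℤ} {m : ℕ} (h : ∀ j ≤ s + m, u j = v j) :
    builtSymbol P e g₀ u s m = builtSymbol P e g₀ v s m := by
  rw [builtSymbol, builtSymbol, builtPast_congr P e g₀ fun j hj => h j hj.le, h _ le_rfl]

lemma Phi_congr {u v : Omega} {n : ℤ} (h : ∀ j ≤ n, u j = v j) :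
    Phi P e g₀ u n = Phi P e g₀ v n := by
  have hr := regenSet_congr P h
  by_cases hne : (regenSet P u n).Nonempty
  · have hne' : (regenSet P v n).Nonempty := hr ▸ hne
    simp only [Phi, if_pos hne, if_pos hne', ← hr]
    have := (Int.csSup_mem hne (bddAbove_regenSet P u n)).1
    exact builtSymbol_congr P e g₀ fun j hj => h j (by omega)
  · have hne' : ¬ (regenSet P v n).Nonempty := hr ▸ hne
    simp only [Phi, if_neg hne, if_neg hne']

lemma measurableSet_mem_regenSet (s n : ℤ) : MeasurableSet {u | s ∈ regenSet P u n} := by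
  have h : {u | s ∈ regenSet P u n} = {_u | s ≤ n} ∩ ⋂ j ∈ Set.Icc s n,
      {u : Omega | (u j : ℝ) < aSeq P (j - s).toNat} := by
    ext u
    simp [regenSet]
  rw [h]
  exact (MeasurableSet.const _).inter (MeasurableSet.biInter (Set.to_countable _) fun j _ =>
    measurableSet_lt (measurable_subtype_coe.comp (measurable_pi_apply j)) measurable_const)

variable [Countable G] [DiscreteMeasurableSpace G]

/-- The uncountable infimum is harmless: the result depends on finitely many letters. -/
lemma measurable_bWord (k : ℕ) (g : G) : Measurable (bWord P k g) :=
  measurable_of_agree k fun _ _ h => bWord_congr P h g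

lemma measurableSet_mem_interval (e : G → ℕ) (l : ℕ) (g : G) :
    MeasurableSet {p : ℝ × (ℕ → G) | p.1 ∈ interval P e l g p.2} := by
  have h1 : Measurable (leftEnd P e l g) := measurable_of_agree l fun _ _ h => by
    simp only [leftEnd, aPrev_congr P h, bWord_congr P h]
  have h2 := measurable_bWord P l g
  exact (measurableSet_le (h1.comp measurable_snd) measurable_fst).inter
    (measurableSet_lt measurable_fst ((h1.comp measurable_snd).add (h2.comp measurable_snd)))

variable [IsMarkovKernel P] {e} (he : Function.Injective e)
include he

/-- From a regeneration time on, symbols depend only on those built since then, so a recursion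
started `d` steps earlier yields the same ones. -/
lemma builtSymbol_add (u : Omega) (s : ℤ) (d m : ℕ)
    (h : ∀ j ≤ m, (u (s + d + j) : ℝ) < aSeq P j) :
    builtSymbol P e g₀ u s (m + d) = builtSymbol P e g₀ u (s + d) m := by
  induction m using Nat.strong_induction_on with
  | _ m ih =>
    have hidx : s + ((m + d : ℕ) : ℤ) = s + d + m := by push_cast; ring
    rw [builtSymbol, builtSymbol, hidx]
    refine symbol_eq_symbol P he (by omega) ⟨(u _).2.1, h m le_rfl⟩ g₀ fun k hk => ?_
    rw [builtPast_apply P e g₀ u s (by omega), builtPast_apply P e g₀ u (s + d) hk,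
      ← ih (m - 1 - k) (by omega) fun j hj => h j (by omega)]
    congr 1
    omega

/-- The maximum of `regenSet` is reached from `s` by `builtSymbol_add`. Freedom in `s` lets one
start serve a whole window and spares the measurability of `τ`. -/
lemma Phi_eq_builtSymbol {u : Omega} {s n : ℤ} (hs : s ∈ regenSet P u n) :
    Phi P e g₀ u n = builtSymbol P e g₀ u s (n - s).toNat := by
  have hne : (regenSet P u n).Nonempty := ⟨s, hs⟩
  have hτ := Int.csSup_mem hne (bddAbove_regenSet P u n)
  have hsτ := le_csSup (bddAbove_regenSet P u n) hs
  simp only [Phi, if_pos hne]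
  set τ := sSup (regenSet P u n)
  have hd : s + ((τ - s).toNat : ℤ) = τ := by omega
  have hτn := hτ.1
  have h := builtSymbol_add P g₀ he u s (τ - s).toNat (n - τ).toNat fun j hj => by
    have := hτ.2 (τ + j) ⟨by omega, by omega⟩
    rwa [show (τ + j - τ).toNat = j by omega, ← hd] at this
  rw [hd] at h
  rw [← h]
  congr 1
  omega

/-- `Φ` solves the recursion driven by the full partition of `[0, 1[`. -/
lemma Phi_eq_iff {u : Omega} {n : ℤ} (hne : (regenSet P u n).Nonempty) (g : G) :
    Phi P e g₀ u n = g ↔ ∃ l, (u n : ℝ) ∈ interval P e l g (past n (Phi P e g₀ u)) := by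
  obtain ⟨s, hs⟩ := hne
  have hsn := hs.1
  have hx : (u n : ℝ) ∈ Set.Ico 0 (aSeq P (n - s).toNat) :=
    ⟨(u n).2.1, hs.2 n ⟨hsn, le_rfl⟩⟩
  rw [← symbol_eq_iff P he hx g₀, Phi_eq_builtSymbol P g₀ he hs, builtSymbol,
    show s + ((n - s).toNat : ℤ) = n by omega, symbol_eq_symbol P he le_rfl hx g₀ fun k hk => ?_]
  rw [builtPast_apply P e g₀ u s hk, past,
    Phi_eq_builtSymbol P g₀ he (mem_regenSet_of_le P hs (by omega) (by omega))]
  congr 1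
  omega

lemma measurable_symbol (m : ℕ) :
    Measurable fun p : ℝ × (ℕ → G) => symbol P e g₀ m p.1 p.2 := by
  refine measurable_to_countable' fun g => ?_
  have hI : MeasurableSet {p : ℝ × (ℕ → G) | p.1 ∈ Set.Ico 0 (aSeq P m)} :=
    measurable_fst measurableSet_Ico
  have h : (fun p : ℝ × (ℕ → G) => symbol P e g₀ m p.1 p.2) ⁻¹' {g} =
      {p | p.1 ∈ Set.Ico 0 (aSeq P m)} ∩ (⋃ l, {p | p.1 ∈ interval P e l g p.2}) ∪
        {p | p.1 ∈ Set.Ico 0 (aSeq P m)}ᶜ ∩ {_p | g₀ = g} := by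
    ext p
    by_cases hp : p.1 ∈ Set.Ico 0 (aSeq P m)
    · have := symbol_eq_iff P he hp g₀ g p.2
      simp only [Set.mem_preimage, Set.mem_singleton_iff, this, Set.mem_union, Set.mem_inter_iff,
        Set.mem_ofPred_eq, Set.mem_iUnion, Set.mem_compl_iff, hp, true_and, not_true_eq_false,
        false_and, or_false]
    · have : symbol P e g₀ m p.1 p.2 = g₀ := dif_neg fun ⟨_, _, _, h⟩ => hp h.1
      simp only [Set.mem_preimage, Set.mem_singleton_iff, this, Set.mem_union, Set.mem_inter_iff,
        Set.mem_ofPred_eq, Set.mem_compl_iff, hp, false_and, not_false_eq_true,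
        true_and, false_or]
  rw [h]
  exact (hI.inter (MeasurableSet.iUnion fun l => measurableSet_mem_interval P e l g)).union
    (hI.compl.inter (MeasurableSet.const _))

lemma measurable_builtPast (s : ℤ) (m : ℕ) : Measurable fun u => builtPast P e g₀ u s m := by
  induction m with
  | zero => exact measurable_const
  | succ m ih =>
    have h := (measurable_symbol P g₀ he m).comp
      ((measurable_subtype_coe.comp (measurable_pi_apply (s + m))).prodMk ih)
    exact measurable_push_prod.comp (h.prodMk ih)

lemma measurable_builtSymbol (s : ℤ) (m : ℕ) :
    Measurable fun u => builtSymbol P e g₀ u s m := by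
  have h := (measurable_symbol P g₀ he m).comp
    ((measurable_subtype_coe.comp (measurable_pi_apply (s + m))).prodMk
      (measurable_builtPast P g₀ he s m))
  exact h

lemma measurable_Phi : Measurable (Phi P e g₀) := by
  refine measurable_pi_lambda _ fun n => measurable_to_countable' fun g => ?_
  have h : (fun u => Phi P e g₀ u n) ⁻¹' {g} =
      (⋃ s, {u | s ∈ regenSet P u n} ∩ (fun u => builtSymbol P e g₀ u s (n - s).toNat) ⁻¹' {g}) ∪
        (⋃ s, {u | s ∈ regenSet P u n})ᶜ ∩ {_u | g₀ = g} := by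
    ext u
    by_cases hne : (regenSet P u n).Nonempty
    · obtain ⟨s, hs⟩ := hne
      simp only [Set.mem_preimage, Set.mem_singleton_iff, Set.mem_union, Set.mem_iUnion,
        Set.mem_inter_iff, Set.mem_ofPred_eq, Set.mem_compl_iff]
      constructor
      · rintro rfl
        exact Or.inl ⟨s, hs, (Phi_eq_builtSymbol P g₀ he hs).symm⟩
      · rintro (⟨s', hs', rfl⟩ | ⟨hn, -⟩)
        · exact Phi_eq_builtSymbol P g₀ he hs'
        · exact absurd ⟨s, hs⟩ hn
    · have h1 : Phi P e g₀ u n = g₀ := if_neg hne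
      have h2 : ∀ s, s ∉ regenSet P u n := fun s hs => hne ⟨s, hs⟩
      simp [h1, h2]
  rw [h]
  exact (MeasurableSet.iUnion fun s => (measurableSet_mem_regenSet P s n).inter
    (measurable_builtSymbol P g₀ he s _ (MeasurableSet.singleton g))).union
    ((MeasurableSet.iUnion fun s => measurableSet_mem_regenSet P s n).compl.inter
      (MeasurableSet.const _))

end Coupling

/-! ### Independence of the present uniform variable from the earlier ones. -/

section Independence

instance isProbabilityMeasure_unifLaw : IsProbabilityMeasure unifLaw := by
  unfold unifLaw
  infer_instance

lemma unifLaw_map_eval (i : ℤ) : unifLaw.map (fun u => u i) = unif :=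
  Measure.infinitePi_map_eval _ i

/-- The `i`-th uniform variable is independent of the variables before it. -/
lemma map_prodMk_eval {S : Type*} [MeasurableSpace S] {X : Omega → S} (hX : Measurable X) {i : ℤ}
    (hdep : DependsOn X (Set.Iio i)) :
    unifLaw.map (fun u => (X u, u i)) = (unifLaw.map X).prod unif := by
  have h1 : iIndepFun (fun (j : ℤ) (u : Omega) => u j) unifLaw :=
    iIndepFun_infinitePi (P := fun _ : ℤ => unif) (X := fun _ x => x) fun _ => measurable_id
  have h2 : Indep (⨆ j ∈ Set.Iio i, MeasurableSpace.comap (fun u : Omega => u j) inferInstance)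
      (⨆ j ∈ ({i} : Set ℤ), MeasurableSpace.comap (fun u : Omega => u j) inferInstance)
      unifLaw :=
    indep_iSup_of_disjoint (fun j => (measurable_pi_apply j).comap_le) h1.iIndep (by simp)
  have hle : MeasurableSpace.comap X inferInstance ≤
      ⨆ j ∈ Set.Iio i, MeasurableSpace.comap (fun u : Omega => u j) inferInstance := by
    -- Freezing the coordinates from `i` on leaves `X` unchanged, which shows that `X` is measurable
    -- for the earlier coordinates.
    let r : Omega → Omega := fun u j => if j < i then u j else ⟨0, by simp⟩
    have hXr : X = X ∘ r := by
      ext u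
      exact hdep fun j hj => (if_pos hj).symm
    rw [hXr, ← MeasurableSpace.comap_comp]
    refine (MeasurableSpace.comap_mono hX.comap_le).trans ?_
    simp only [MeasurableSpace.pi, MeasurableSpace.comap_iSup, MeasurableSpace.comap_comp]
    refine iSup_le fun j => ?_
    by_cases hj : j < i
    · have : (fun u : Omega => u j) ∘ r = fun u => u j := funext fun u => if_pos hj
      rw [this]
      exact le_iSup₂_of_le j hj le_rfl
    · have : (fun u : Omega => u j) ∘ r = fun _ => ⟨0, by simp⟩ := funext fun u => if_neg hj
      rw [this, MeasurableSpace.comap_const]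
      exact bot_le
  have h3 : IndepFun X (fun u => u i) unifLaw := by
    rw [IndepFun_iff_Indep]
    refine indep_of_indep_of_le_left (indep_of_indep_of_le_right h2 ?_) hle
    simp
  rw [h3.map_prod_eq_prod_map_map hX.aemeasurable (measurable_pi_apply i).aemeasurable,
    unifLaw_map_eval]

lemma unif_real_lt {c : ℝ} (hc : c ∈ Set.Icc (0 : ℝ) 1) :
    unif.real {x | (x : ℝ) < c} = c := by
  have h : (Subtype.val '' {x : Set.Ico (0 : ℝ) 1 | (x : ℝ) < c}) = Set.Ico 0 c := by
    ext x
    simp only [Set.mem_image, Set.mem_ofPred_eq, Subtype.exists, exists_and_left, exists_prop,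
      exists_eq_right_right, Set.mem_Ico]
    constructor
    · exact fun h => ⟨h.2.1, h.1⟩
    · exact fun h => ⟨h.2, h.1, h.2.trans_le hc.2⟩
  rw [measureReal_def, unif, (MeasurableEmbedding.subtype_coe measurableSet_Ico).comap_apply, h]
  simp [hc.1]

end Independence

/-! ### Regeneration times and compatibility of the law of `Φ(U)`. -/

section Regeneration

variable (a : ℕ → ℝ)

/-- The house-of-cards chain driven by `u`, started at the origin at time `i`. -/
noncomputable def cardsState (u : Omega) (i : ℤ) : ℕ → ℕ
  | 0 => 0
  | k + 1 => if (u (i + k) : ℝ) < a (cardsState u i k) then cardsState u i k + 1 else 0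

lemma cardsState_dependsOn (i : ℤ) (k : ℕ) :
    DependsOn (fun u => cardsState a u i k) (Set.Iio (i + k)) := by
  induction k with
  | zero => exact fun _ _ _ => rfl
  | succ k ih =>
    intro u v h
    have h1 := ih fun j hj => h j (lt_trans (Set.mem_Iio.1 hj) (by push_cast; omega))
    have h2 := h (i + k) (by push_cast; simp)
    simp only [cardsState] at h1 ⊢
    rw [h1, h2]

lemma measurable_cardsState (i : ℤ) (k : ℕ) : Measurable fun u => cardsState a u i k := by
  induction k with
  | zero => exact measurable_const
  | succ k ih =>
    exact Measurable.ite (measurableSet_lt (measurable_subtype_coe.comp (measurable_pi_apply _))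
      ((measurable_of_countable a).comp ih)) (ih.add_const 1) measurable_const

/-- A state `c` records `c` consecutive climbs from the origin; if `c > 0`, the time `i + k - c` is
thus admissible in `regenSet` for `i + k - 1`. -/
lemma lt_of_cardsState (u : Omega) (i : ℤ) (k : ℕ) :
    ∀ j < cardsState a u i k, (u (i + k - cardsState a u i k + j) : ℝ) < a j := by
  induction k with
  | zero => intro j hj; simp [cardsState] at hj
  | succ k ih =>
    intro j hj
    rw [cardsState] at hj ⊢
    split_ifs at hj ⊢ with h
    · have hidx : i + ((k + 1 : ℕ) : ℤ) - ((cardsState a u i k + 1 : ℕ) : ℤ) + j =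
          i + k - cardsState a u i k + j := by push_cast; ring
      rw [hidx]
      rcases Nat.lt_succ_iff_lt_or_eq.1 hj with hj | rfl
      · exact ih j hj
      · convert h using 3
        ring
    · omega

variable {a}

/-- The state after `k` steps is independent of the next uniform variable, whose integration applies
`cardsOp` once. -/
lemma integral_cardsState (ha : ∀ x, a x ∈ Set.Icc (0 : ℝ) 1) {h : ℕ → ℝ} {C : ℝ}
    (hC : ∀ x, |h x| ≤ C) (i : ℤ) (k : ℕ) :
    ∫ u, h (cardsState a u i k) ∂unifLaw = (cardsOp a)^[k] h 0 := by
  induction k generalizing h with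
  | zero => simp [cardsState]
  | succ k ih =>
    have hKC : ∀ x, |cardsOp a h x| ≤ C := by
      intro x
      have h1 := abs_le.1 (hC (x + 1))
      have h2 := abs_le.1 (hC 0)
      have h3 := ha x
      rw [abs_le, cardsOp]
      constructor <;> nlinarith [h3.1, h3.2]
    have hF : Measurable fun p : ℕ × Set.Ico (0 : ℝ) 1 =>
        h (if (p.2 : ℝ) < a p.1 then p.1 + 1 else 0) :=
      (measurable_of_countable h).comp (Measurable.ite
        (measurableSet_lt (measurable_subtype_coe.comp measurable_snd)
          ((measurable_of_countable a).comp measurable_fst))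
        (measurable_fst.add_const 1) measurable_const)
    have hX := measurable_cardsState a i k
    have : IsProbabilityMeasure (unifLaw.map fun u => cardsState a u i k) :=
      Measure.isProbabilityMeasure_map hX.aemeasurable
    have h1 := integral_map (μ := unifLaw) (φ := fun u => (cardsState a u i k, u (i + k)))
      (hX.prodMk (measurable_pi_apply (i + k))).aemeasurable hF.aestronglyMeasurable
    have hinner : ∀ y : ℕ, ∫ x : Set.Ico (0 : ℝ) 1, h (if (x : ℝ) < a y then y + 1 else 0) ∂unif =
        cardsOp a h y := by
      intro y
      have hm : MeasurableSet {x : Set.Ico (0 : ℝ) 1 | (x : ℝ) < a y} :=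
        measurableSet_lt measurable_subtype_coe measurable_const
      have h2 : (fun x : Set.Ico (0 : ℝ) 1 => h (if (x : ℝ) < a y then y + 1 else 0)) =
          fun x => Set.indicator {x : Set.Ico (0 : ℝ) 1 | (x : ℝ) < a y}
            (fun _ => h (y + 1) - h 0) x + h 0 := by
        ext x
        by_cases hx : (x : ℝ) < a y <;> simp [Set.indicator, hx]
      rw [h2, integral_add ((integrable_const _).indicator hm) (integrable_const _),
        integral_indicator hm, setIntegral_const, unif_real_lt (ha y)]
      simp only [integral_const, probReal_univ, smul_eq_mul, cardsOp]
      ring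
    rw [map_prodMk_eval hX (cardsState_dependsOn a i k),
      integral_prod _ (integrable_of_abs_le hF fun _ => hC _)] at h1
    simp only [hinner] at h1
    rw [integral_map hX.aemeasurable (measurable_of_countable _).aestronglyMeasurable,
      ih hKC] at h1
    exact h1.symm

lemma unifLaw_real_cardsState_eq_zero (ha : ∀ x, a x ∈ Set.Icc (0 : ℝ) 1) (i : ℤ) (k : ℕ) :
    unifLaw.real {u | cardsState a u i k = 0} = rho a k := by
  have hm : MeasurableSet {u | cardsState a u i k = 0} :=
    measurable_cardsState a i k (MeasurableSet.singleton 0)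
  rw [rho_eq_iterate, ← integral_cardsState ha (C := 1) (fun x => ?_) i k,
    ← integral_indicator_one hm]
  · exact integral_congr_ae (Eventually.of_forall fun u => by simp [point, Set.indicator])
  · simp only [point]
    split_ifs <;> simp

variable {G : Type*} [MeasurableSpace G] [Countable G] [DiscreteMeasurableSpace G]
  (P : Kernel (ℕ → G) G) [IsMarkovKernel P]

lemma ae_regenSet_nonempty (hρ : Tendsto (rho (aSeq P)) atTop (nhds 0)) (n : ℤ) :
    ∀ᵐ u ∂unifLaw, (regenSet P u n).Nonempty := by
  have hle : ∀ k : ℕ, unifLaw.real {u | ¬ (regenSet P u n).Nonempty} ≤ rho (aSeq P) k := by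
    intro k
    -- Starting at `n + 1 - k`, the `k` steps use exactly the variables up to `u n`.
    rw [← unifLaw_real_cardsState_eq_zero (aSeq_mem_Icc P) (n + 1 - k) k]
    refine measureReal_mono fun u hu => ?_
    by_contra h0
    refine hu ⟨n + 1 - cardsState (aSeq P) u (n + 1 - k) k, ?_, fun j hj => ?_⟩
    · have : cardsState (aSeq P) u (n + 1 - k) k ≠ 0 := h0
      omega
    · have h1 := hj.1
      have h2 := hj.2
      set c := cardsState (aSeq P) u (n + 1 - k) k with hc
      have h := lt_of_cardsState (aSeq P) u (n + 1 - k) k (j - (n + 1 - c)).toNat (by omega)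
      rw [← hc] at h
      convert h using 3
      omega
  have h0 : unifLaw.real {u | ¬ (regenSet P u n).Nonempty} = 0 :=
    le_antisymm (ge_of_tendsto' hρ hle) measureReal_nonneg
  exact (measureReal_eq_zero_iff).1 h0

variable {e : G → ℕ} (he : Function.Injective e) (g₀ : G)
include he

lemma isCompatible_muPhi (ha : Tendsto (aSeq P) atTop (nhds 1))
    (hρ : Tendsto (rho (aSeq P)) atTop (nhds 0)) : IsCompatible P (muPhi P e g₀) := by
  have hΦ := measurable_Phi P g₀ he
  have : IsProbabilityMeasure (muPhi P e g₀) := Measure.isProbabilityMeasure_map hΦ.aemeasurable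
  refine isCompatible_iff.2 fun i g s hs => ?_
  have hX : Measurable fun u => past i (Phi P e g₀ u) := (measurable_past i).comp hΦ
  have hdep : DependsOn (fun u => past i (Phi P e g₀ u)) (Set.Iio i) := fun u v h =>
    past_congr fun j hj => Phi_congr P e g₀ fun k hk => h k (lt_of_le_of_lt hk hj)
  have : IsProbabilityMeasure (unifLaw.map fun u => past i (Phi P e g₀ u)) :=
    Measure.isProbabilityMeasure_map hX.aemeasurable
  -- On `D` the pair (past of `Φ`, `u i`) encodes the event; its section at `w ∈ s` has measure `P w
  -- {g}`.
  set D : Set ((ℕ → G) × Set.Ico (0 : ℝ) 1) :=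
    {p | p.1 ∈ s ∧ ∃ l, (p.2 : ℝ) ∈ interval P e l g p.1} with hD
  have hDm : MeasurableSet D := by
    have h1 : D = Prod.fst ⁻¹' s ∩ ⋃ l, (fun p : (ℕ → G) × Set.Ico (0 : ℝ) 1 =>
        ((p.2 : ℝ), p.1)) ⁻¹' {p : ℝ × (ℕ → G) | p.1 ∈ interval P e l g p.2} := by
      ext p
      simp [hD]
    rw [h1]
    exact (measurable_fst hs).inter (MeasurableSet.iUnion fun l =>
      ((measurable_subtype_coe.comp measurable_snd).prodMk measurable_fst)
        (measurableSet_mem_interval P e l g))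
  have hset : MeasurableSet (past i ⁻¹' s ∩ {η : ℤ → G | η i = g}) :=
    (measurable_past i hs).inter (show MeasurableSet ((fun η : ℤ → G => η i) ⁻¹' {g}) from
      (measurable_pi_apply i) (MeasurableSet.singleton g))
  have h1 : muPhi P e g₀ (past i ⁻¹' s ∩ {η : ℤ → G | η i = g}) =
      unifLaw ((fun u => (past i (Phi P e g₀ u), u i)) ⁻¹' D) := by
    rw [muPhi, Measure.map_apply hΦ hset]
    refine measure_congr ?_
    filter_upwards [ae_regenSet_nonempty P hρ i] with u hu
    exact propext (and_congr_right fun _ => Phi_eq_iff P g₀ he hu g)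
  have h2 : unifLaw ((fun u => (past i (Phi P e g₀ u), u i)) ⁻¹' D) =
      ∫⁻ w in s, P w {g} ∂(unifLaw.map fun u => past i (Phi P e g₀ u)) := by
    rw [← Measure.map_apply (hX.prodMk (measurable_pi_apply i)) hDm, map_prodMk_eval hX hdep,
      Measure.prod_apply hDm, ← lintegral_indicator hs]
    refine lintegral_congr fun w => ?_
    by_cases hw : w ∈ s
    · rw [Set.indicator_of_mem hw, ← unif_iUnion_interval P he ha g w]
      simp [hD, hw]
    · rw [Set.indicator_of_notMem hw]
      simp [hD, hw]
  rw [measureReal_def, h1, h2, muPhi, Measure.map_map (measurable_past i) hΦ]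
  exact (integral_toReal (P.measurable_coe (MeasurableSet.singleton g)).aemeasurable
    (Eventually.of_forall fun w => measure_lt_top _ _)).symm

end Regeneration

end LongMemory

theorem corollary4p3 {G : Type*} [Countable G] [MeasurableSpace G] [DiscreteMeasurableSpace G]
    (P : Kernel (ℕ → G) G) [IsMarkovKernel P] :
    -- loss of memory
    (∀ μ : Measure (ℤ → G), LongMemory.IsCompatible P μ →
      ∀ (s t i : ℤ), s ≤ t → i ≤ s →
      ∀ f : (ℤ → G) → ℝ, DependsOn f (Set.Icc s t) → BddAbove (Set.range fun η => |f η|) →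
        (μ[f | LongMemory.pastSigma G i] =ᵐ[μ] LongMemory.condMean P i t f) ∧
        ∀ w v : ℤ → G,
          |LongMemory.condMean P i t f w - LongMemory.condMean P i t f v| ≤
            2 * (⨆ η, |f η|) * ∑ j ∈ Finset.range ((t - s).toNat + 1),
              LongMemory.rho (LongMemory.aSeq P) ((s - i).toNat + j)) ∧
    -- uniqueness
    (Tendsto (fun n => ∑ m ∈ Finset.range n, LongMemory.betaSeq P m) atTop atTop →
      ∀ e : G → ℕ, Function.Injective e → ∀ g₀ : G,
        LongMemory.IsCompatible P (LongMemory.muPhi P e g₀) ∧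
        ∀ ν : Measure (ℤ → G), LongMemory.IsCompatible P ν → ν = LongMemory.muPhi P e g₀) := by
  refine ⟨fun μ hμ s t i hst his f hf hbdd => ?_, fun hb e he g₀ => ?_⟩
  · have hC : ∀ η, |f η| ≤ ⨆ η, |f η| := fun η => le_ciSup hbdd η
    exact ⟨hμ.condExp_eq_condMean hf hC (by omega),
      fun w v => LongMemory.abs_condMean_sub_le P hf hC hst his w v⟩
  · have hρ := LongMemory.tendsto_rho (LongMemory.aSeq_mem_Icc P) (LongMemory.aSeq_mono P) hb
    have ha := LongMemory.tendsto_one_of_sum_prod (LongMemory.aSeq_mem_Icc P)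
      (LongMemory.aSeq_mono P) hb
    have hΦ := LongMemory.isCompatible_muPhi P he g₀ ha hρ
    exact ⟨hΦ, fun ν hν => hν.unique hΦ hρ⟩
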